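/- Let $p$ be a prime and let $(R,\mathfrak m,k)$ be a Noetherian local ring of characteristic $p$ and Krull dimension $d$. For $e\ge 0$ let $F^e_*R$ denote $R$ as an $R$-module by restriction of scalars along the $e$-th iterate of Frobenius, so that $r\cdot F^e_*x=F^e_*(r^{p^e}x)$. Assume that $R$ is $F$-finite, i.e. $F_*R$ is a finitely generated $R$-module, and put $\alpha(R)=\log_p[k:k^p]$. A Cartier subalgebra on $R$ is a graded subring $\mathcal D=\bigoplus_{e\ge0}\mathcal D_e$ of $\bigoplus_{e\ge 0}\operatorname{Hom}_R(F^e_*R,R)$, with multiplication $\phi_1\cdot\phi_2=\phi_1\circ F^{e_1}_*\phi_2$ for $\phi_i$ of degree $e_i$, such that $\mathcal D_0=\operatorname{Hom}_R(R,R)=R$ and $\mathcal D_e\neq0$ for some $e>0$. Let $a_e^{\mathcal D}$ be the maximal number of $\mathcal D$-summands in a direct sum decomposition $F^e_*R\simeq\bigoplus_i M_i$ of $R$-modules, where $M_j$ is a $\mathcal D$-summand if $M_j\simeq R$ and the projection $F^e_*R\to M_j\simeq R$ belongs to $\mathcal D_e$. Put $\Gamma_{\mathcal D}=\{e : a_e^{\mathcal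 D}\ne0\}$. The $F$-signature of $(R,\mathcal D)$ is $$s(R,\mathcal D)=\lim_{e\in\Gamma_{\mathcal D},\ e\to\infty}\frac{a_e^{\mathcal D}}{p^{e(d+\alpha(R))}},$$ with $s(R,\mathcal D)=0$ by convention if $\Gamma_{\mathcal D}$ is finite, i.e. contains no $e>0$. Let $\mathcal E\subseteq\mathcal D$ be Cartier subalgebras on $R$, and suppose that there is $c\in R$, not in any minimal prime of $R$, such that $\mathcal D_e\cdot F^e_*c\subseteq\mathcal E_e$ for all $e>0$, i.e. the map $F^e_*x\mapsto\phi(F^e_*(cx))$ belongs to $\mathcal E_e$ for every $\phi\in\mathcal D_e$. Then $s(R,\mathcal D)$ and $s(R,\mathcal E)$ exist and $$s(R,\mathcal D)=s(R,\mathcal E).$$ -/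

import Mathlib

open Filter Topology

universe u

namespace FSig

section Pushforward

/-- `F^e_* R`: a copy of the additive group of `R`, on which `r : R` acts as multiplication
by `r ^ p ^ e`. -/
def FrobPush (R : Type u) (_p _e : ℕ) : Type u := R

variable (R : Type u) [CommRing R] (p e : ℕ)

instance : AddCommGroup (FrobPush R p e) := inferInstanceAs (AddCommGroup R)

/-- The additive bijection `x ↦ F^e_* x`. -/
def push : R ≃+ FrobPush R p e := AddEquiv.refl R

variable [Fact p.Prime] [CharP R p]

/-- The `R`-module structure of `F^e_* R`, by restriction of scalars along the `e`-th iterate of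
the Frobenius endomorphism. -/
noncomputable instance : Module R (FrobPush R p e) :=
  Module.compHom R (iterateFrobenius R p e)

variable {R p e}

theorem smul_push (r x : R) : r • push R p e x = push R p e (r ^ p ^ e * x) := rfl

variable (R p)

/-- `R` is `F`-finite: `F_* R` is a finitely generated `R`-module. -/
def IsFFinite : Prop := Module.Finite R (FrobPush R p 1)

end Pushforward

section CartierMaps

variable (R : Type u) [CommRing R] (p : ℕ) [Fact p.Prime] [CharP R p]

/-- The `p^{-e}`-linear maps on `R`, i.e. the degree `e` part `Hom_R(F^e_* R, R)` of the total
Cartier algebra of `R`. -/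
abbrev CartierMap (e : ℕ) : Type u := FrobPush R p e →ₗ[R] R

variable {R p}

/-- The product in the total Cartier algebra: `φ · ψ = φ ∘ F^a_* ψ`, that is
`F^{a+b}_* x ↦ φ (F^a_* (ψ (F^b_* x)))`. -/
noncomputable def CartierMap.mul {a b : ℕ} (φ : CartierMap R p a) (ψ : CartierMap R p b) :
    CartierMap R p (a + b) where
  toFun x := φ (push R p a (ψ (push R p b ((push R p (a + b)).symm x))))
  map_add' x y := by simp only [map_add]
  map_smul' r x := by
    obtain ⟨x, rfl⟩ := (push R p (a + b)).surjective x
    rw [smul_push, AddEquiv.symm_apply_apply, AddEquiv.symm_apply_apply, pow_add, pow_mul,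
      ← smul_push, map_smul, smul_eq_mul, ← smul_push, map_smul, RingHom.id_apply]

/-- `φ · F^e_* c`, the map `F^e_* x ↦ φ (F^e_* (c x))`. -/
noncomputable def CartierMap.mulPush {e : ℕ} (φ : CartierMap R p e) (c : R) :
    CartierMap R p e where
  toFun x := φ (push R p e (c * (push R p e).symm x))
  map_add' x y := by simp only [map_add, mul_add]
  map_smul' r x := by
    obtain ⟨x, rfl⟩ := (push R p e).surjective x
    rw [smul_push, AddEquiv.symm_apply_apply, AddEquiv.symm_apply_apply, mul_left_comm,
      ← smul_push, map_smul, RingHom.id_apply]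

variable (R p)

/-- A Cartier subalgebra on `R`, given by its homogeneous parts: a graded subring
`⨁ D_e` of the total Cartier algebra `⨁ Hom_R(F^e_* R, R)` (the field `zero_eq_top` gives the unit;
closure under `𝔽_p`-scalars is automatic for additive subgroups) with `D_0 = Hom_R(R, R)` and
`D_e ≠ 0` for some `e > 0`. -/
structure CartierSubalgebra where
  /-- The degree `e` part. -/
  part : (e : ℕ) → AddSubgroup (CartierMap R p e)
  zero_eq_top : part 0 = ⊤
  mul_mem : ∀ {a b : ℕ} {φ : CartierMap R p a} {ψ : CartierMap R p b},
    φ ∈ part a → ψ ∈ part b → φ.mul ψ ∈ part (a + b)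
  exists_ne_bot : ∃ e, 0 < e ∧ part e ≠ ⊥

/-- Inclusion of Cartier subalgebras, degree by degree. -/
instance : LE (CartierSubalgebra R p) := ⟨fun E D => ∀ e, E.part e ≤ D.part e⟩

end CartierMaps

section SplittingNumbers

/-- The projection onto the `j`-th summand of an internal direct sum decomposition. -/
noncomputable def summandProj {R : Type u} [CommRing R] {N : Type u} [AddCommGroup N] [Module R N]
    {n : ℕ} (M : Fin n → Submodule R N) (hM : DirectSum.IsInternal M) (j : Fin n) :
    N →ₗ[R] M j :=
  DirectSum.component R (Fin n) (fun i => M i) j ∘ₗ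
    (LinearEquiv.ofBijective (DirectSum.coeLinearMap M) hM).symm.toLinearMap

variable {R : Type u} [CommRing R] {p : ℕ} [Fact p.Prime] [CharP R p]

/-- In the decomposition `F^e_* R = ⨁ M_i`, the summand `M_j` is a `D`-summand: `M_j ≃ R` and the
projection `F^e_* R → M_j ≃ R` belongs to `D_e`. -/
def IsDSummand (D : CartierSubalgebra R p) (e : ℕ) {n : ℕ}
    (M : Fin n → Submodule R (FrobPush R p e)) (hM : DirectSum.IsInternal M) (j : Fin n) : Prop :=
  ∃ f : M j ≃ₗ[R] R, f.toLinearMap ∘ₗ summandProj M hM j ∈ D.part e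

/-- The possible numbers of `D`-summands in the direct sum decompositions of `F^e_* R`. -/
def summandCounts (D : CartierSubalgebra R p) (e : ℕ) : Set ℕ :=
  {a | ∃ (n : ℕ) (M : Fin n → Submodule R (FrobPush R p e)) (hM : DirectSum.IsInternal M),
    a = Set.ncard {j | IsDSummand D e M hM j}}

/-- The `e`-th `F`-splitting number `a_e^D`: the maximal number of `D`-summands in a direct sum
decomposition of `F^e_* R` (see `isGreatest_splittingNumber`). -/
noncomputable def splittingNumber (D : CartierSubalgebra R p) (e : ℕ) : ℕ :=
  sSup (summandCounts D e)

theorem finite_frobPush (hF : IsFFinite R p) (e : ℕ) : Module.Finite R (FrobPush R p e) := by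
  have key : ∀ n, (iterateFrobenius R p n).Finite ↔ Module.Finite R (FrobPush R p n) :=
    fun _ => Iff.rfl
  rw [← key]
  have h1 : (iterateFrobenius R p 1).Finite := (key 1).2 hF
  induction e with
  | zero =>
    have : iterateFrobenius R p 0 = RingHom.id R := by
      ext x; simp
    rw [this]; exact RingHom.Finite.id R
  | succ n ih =>
    have : iterateFrobenius R p (n + 1) = (iterateFrobenius R p n).comp (iterateFrobenius R p 1) := by
      ext x; simp [iterateFrobenius_def, frobenius_def, pow_succ', pow_mul]
    rw [this]; exact ih.comp h1

theorem isGreatest_splittingNumber [Nontrivial R] (hF : IsFFinite R p)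
    (D : CartierSubalgebra R p) (e : ℕ) :
    IsGreatest (summandCounts D e) (splittingNumber D e) := by
  have := finite_frobPush hF e
  obtain ⟨m, g, hg⟩ := Module.Finite.exists_fin' R (FrobPush R p e)
  have hbdd : BddAbove (summandCounts D e) := by
    refine ⟨m, ?_⟩
    rintro a ⟨n, M, hM, rfl⟩
    set S := {j | IsDSummand D e M hM j} with hS
    choose f hf using fun j : S => j.2
    let P : FrobPush R p e →ₗ[R] (S → R) :=
      LinearMap.pi fun j => (f j).toLinearMap ∘ₗ summandProj M hM j
    have hP : Function.Surjective P := by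
      intro v
      let w : DirectSum (Fin n) fun i => M i :=
        DFinsupp.equivFunOnFintype.symm
          fun i => open Classical in if h : i ∈ S then (f ⟨i, h⟩).symm (v ⟨i, h⟩) else 0
      refine ⟨LinearEquiv.ofBijective (DirectSum.coeLinearMap M) hM w, ?_⟩
      funext j
      have : summandProj M hM j (LinearEquiv.ofBijective (DirectSum.coeLinearMap M) hM w) =
          (f j).symm (v j) := by
        simp only [summandProj, LinearMap.comp_apply, LinearEquiv.coe_coe,
          LinearEquiv.symm_apply_apply]
        change DFinsupp.equivFunOnFintype w j = _
        simp only [w, Equiv.apply_symm_apply]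
        rw [dif_pos j.2]
      simp [P, this]
    have : Fintype S := Fintype.ofFinite S
    have := card_le_of_surjective R (P ∘ₗ g) (hP.comp hg)
    rw [Fintype.card_fin, ← Nat.card_eq_fintype_card] at this
    exact this
  refine ⟨Nat.sSup_mem ?_ hbdd, fun a ha => le_csSup hbdd ha⟩
  exact ⟨_, 1, fun _ => ⊤, DirectSum.isInternal_submodule_of_iSupIndep_of_iSup_eq_top
    (iSupIndep_subsingleton _) (by simp), rfl⟩

/-- The semigroup `Γ_D` of all `e` with `a_e^D ≠ 0`. -/
def semigroup (D : CartierSubalgebra R p) : Set ℕ := {e | splittingNumber D e ≠ 0}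

end SplittingNumbers

section Signature

variable (R : Type u) [CommRing R] [IsLocalRing R] (p : ℕ) [Fact p.Prime] [CharP R p]

theorem charP_residueField : CharP (IsLocalRing.ResidueField R) p := by
  have h : (p : IsLocalRing.ResidueField R) = 0 := by
    rw [← map_natCast (IsLocalRing.residue R) p, CharP.cast_eq_zero, map_zero]
  obtain ⟨q, hq⟩ := CharP.exists (IsLocalRing.ResidueField R)
  have hd : q ∣ p := (CharP.cast_eq_zero_iff (IsLocalRing.ResidueField R) q p).1 h
  rcases (Nat.dvd_prime (Fact.out : p.Prime)).1 hd with h1 | h1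
  · exact absurd h1 (CharP.char_ne_one (IsLocalRing.ResidueField R) q)
  · exact h1 ▸ hq

/-- `α(R) = log_p [k : k^p]`, where `k` is the residue field of `R`. -/
noncomputable def alpha : ℝ :=
  haveI := charP_residueField R p
  Real.logb p (Module.finrank (frobenius (IsLocalRing.ResidueField R) p).fieldRange
    (IsLocalRing.ResidueField R))

variable {R p}

/-- `s` is the `F`-signature of `(R, D)`: the limit of `a_e^D / p^{e (d + α(R))}` as `e → ∞` in
`Γ_D`, where `d = dim R`. If `Γ_D` has no arbitrarily large elements (that is, when no map in any
`D_e` with `e > 0` is surjective), the `F`-signature is `0` by convention. -/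
def HasFSignature (D : CartierSubalgebra R p) (s : ℝ) : Prop :=
  ∃ d : ℕ, ringKrullDim R = d ∧
    ((semigroup D).Infinite →
      Tendsto (fun e : ℕ => (splittingNumber D e : ℝ) / (p : ℝ) ^ ((e : ℝ) * (d + alpha R p)))
        (atTop ⊓ 𝓟 (semigroup D)) (𝓝 s)) ∧
    ((semigroup D).Finite → s = 0)

theorem HasFSignature.unique {D : CartierSubalgebra R p} {s t : ℝ} (hs : HasFSignature D s)
    (ht : HasFSignature D t) : s = t := by
  obtain ⟨d, hd, h1, h2⟩ := hs
  obtain ⟨d', hd', h1', h2'⟩ := ht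
  obtain rfl : d = d' := by rw [hd] at hd'; exact_mod_cast hd'
  rcases (semigroup D).finite_or_infinite with h | h
  · rw [h2 h, h2' h]
  · haveI : (atTop ⊓ 𝓟 (semigroup D)).NeBot :=
      frequently_mem_iff_neBot.1 (Nat.frequently_atTop_iff_infinite.2 h)
    exact tendsto_nhds_unique (h1 h) (h1' h)

end Signature

end FSig

/-! Write `q = p ^ e` and `n = p ^ d * [k : k^p]`, so that the normalizing factor is `n ^ e`. The
number `a_e^D` is the largest `b` for which `b` maps in `D_e` are jointly surjective onto `R ^ b`;
linear algebra over the residue field shows that a family in `D_e` whose joint cokernel needs `g`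
generators has at most `a_e^D + g` members (`card_le_splittingNumber_add`).

The error terms count generators of `F^e_*(R/c)` for a nonzerodivisor `c`. Since `dim R/c ≤ d - 1`,
this number is `O(n ^ e / p ^ e)` (`exists_frobGen_span_singleton`). If `Γ_D` is infinite, some
Frobenius iterate splits, so `R` is reduced and the given `c` is a nonzerodivisor. Precomposing a
jointly surjective family in `D_e` with `F^e_* c` lands in `E_e` and costs at most that many
generators, so `a_e^D - a_e^E = o(n ^ e)`.

It remains to find the limit for `D`. If `R` is reduced but not a domain, some nonzerodivisor `x +
y` is sent into the maximal ideal by every map, and the limit is `0`. If `R` is a domain, the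
generic rank of `F^e_* R` is `r ^ e` with `r ≤ n`. As `a_e^D ≤ r ^ e`, the limit is `0` when `r <
n`. When `r = n`, composing with maps of degree `m ∈ Γ_D` shows that `a_e^D / n ^ e` increases along
translation by `m` up to `O(p ^ (-e))`, which forces convergence along `Γ_D`. -/

namespace FSig

/-! ### Splitting numbers as sizes of jointly surjective families -/

section SplittingNumberBounds

variable {R : Type u} [CommRing R] {p : ℕ} [Fact p.Prime] [CharP R p]

theorem CartierMap.map_sum_pow_mul {e : ℕ} (φ : CartierMap R p e) {ι : Type*} (s : Finset ι)
    (r u : ι → R) :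
    φ (push R p e (∑ i ∈ s, r i ^ p ^ e * u i)) = ∑ i ∈ s, r i * φ (push R p e (u i)) := by
  simp only [map_sum, ← smul_push, map_smul, smul_eq_mul]

theorem CartierMap.mulPush_apply {e : ℕ} (φ : CartierMap R p e) (c x : R) :
    φ.mulPush c (push R p e x) = φ (push R p e (c * x)) := rfl

theorem CartierMap.mul_apply {a b : ℕ} (φ : CartierMap R p a) (ψ : CartierMap R p b) (x : R) :
    φ.mul ψ (push R p (a + b) x) = φ (push R p a (ψ (push R p b x))) := rfl

/-- Multiplication by `c` is an element of degree `0`, and `D_0` contains all of these. -/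
theorem CartierSubalgebra.mulPush_mem (D : CartierSubalgebra R p) {e : ℕ} {φ : CartierMap R p e}
    (hφ : φ ∈ D.part e) (c : R) : φ.mulPush c ∈ D.part e := by
  let ψ : CartierMap R p 0 :=
    { toFun := fun x => c * (push R p 0).symm x
      map_add' := fun x y => by simp only [map_add, mul_add]
      map_smul' := fun r x => by
        obtain ⟨x, rfl⟩ := (push R p 0).surjective x
        rw [smul_push, AddEquiv.symm_apply_apply, AddEquiv.symm_apply_apply, pow_zero, pow_one,
          RingHom.id_apply, smul_eq_mul, mul_left_comm] }
  have hψ : ψ ∈ D.part 0 := by rw [D.zero_eq_top]; trivial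
  exact D.mul_mem hφ hψ

theorem summandProj_apply_eq {N : Type u} [AddCommGroup N] [Module R N] {n : ℕ}
    (M : Fin n → Submodule R N) (hM : DirectSum.IsInternal M) (j : Fin n) (φ : N →ₗ[R] R)
    (hφ : ∀ i, i ≠ j → ∀ x ∈ M i, φ x = 0) (x : N) : φ (summandProj M hM j x) = φ x := by
  classical
  obtain ⟨w, rfl⟩ := (LinearEquiv.ofBijective (DirectSum.coeLinearMap M) hM).surjective x
  have h1 : summandProj M hM j (LinearEquiv.ofBijective (DirectSum.coeLinearMap M) hM w) = w j := by
    simp only [summandProj, LinearMap.comp_apply, LinearEquiv.coe_coe,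
      LinearEquiv.symm_apply_apply]
    rfl
  rw [h1]
  change _ = φ (DirectSum.coeLinearMap M w)
  induction w using DirectSum.induction_on with
  | zero => simp
  | of i y =>
    rw [DirectSum.coeLinearMap_of]
    by_cases h : i = j
    · subst h; rw [DirectSum.of_eq_same]
    · rw [DirectSum.of_eq_of_ne _ _ _ (Ne.symm h), hφ i h y y.2]; simp
  | add a b ha hb =>
    rw [DirectSum.add_apply, Submodule.coe_add, map_add, map_add, map_add, ← ha, ← hb]
    · simp [summandProj, DirectSum.component]
      rfl
    · simp [summandProj, DirectSum.component]
      rfl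

theorem exists_surjective_of_splittingNumber [Nontrivial R] (hF : IsFFinite R p)
    (D : CartierSubalgebra R p) (e : ℕ) :
    ∃ φ : Fin (splittingNumber D e) → CartierMap R p e, (∀ i, φ i ∈ D.part e) ∧
      ∀ v : Fin (splittingNumber D e) → R, ∃ x : R, ∀ i, φ i (push R p e x) = v i := by
  obtain ⟨n, M, hM, ha⟩ := (isGreatest_splittingNumber hF D e).1
  set S := {j | IsDSummand D e M hM j} with hS
  choose f hf using fun j : S => j.2
  have key : ∀ v : S → R, ∃ x : R, ∀ j : S,
      ((f j).toLinearMap ∘ₗ summandProj M hM j) (push R p e x) = v j := by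
    intro v
    let w : DirectSum (Fin n) fun i => M i :=
      DFinsupp.equivFunOnFintype.symm
        fun i => open Classical in if h : i ∈ S then (f ⟨i, h⟩).symm (v ⟨i, h⟩) else 0
    refine ⟨(push R p e).symm (LinearEquiv.ofBijective (DirectSum.coeLinearMap M) hM w), ?_⟩
    intro j
    rw [AddEquiv.apply_symm_apply]
    have : summandProj M hM j (LinearEquiv.ofBijective (DirectSum.coeLinearMap M) hM w) =
        (f j).symm (v j) := by
      simp only [summandProj, LinearMap.comp_apply, LinearEquiv.coe_coe,
        LinearEquiv.symm_apply_apply]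
      change DFinsupp.equivFunOnFintype w j = _
      simp only [w, Equiv.apply_symm_apply]
      rw [dif_pos j.2]
    simp [this]
  have hc : Nat.card S = splittingNumber D e := ha.symm
  let E : S ≃ Fin (splittingNumber D e) := (Finite.equivFin S).trans (finCongr hc)
  refine ⟨fun i => (f (E.symm i)).toLinearMap ∘ₗ summandProj M hM (E.symm i),
    fun i => hf _, fun v => ?_⟩
  obtain ⟨x, hx⟩ := key (v ∘ E)
  exact ⟨x, fun i => by simpa using hx (E.symm i)⟩

/-- Preimages `y j` of the standard basis vectors split the joint map, so `F^e_* R` is the direct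
sum of its kernel and the free lines `R • y j`. On each line the projection is the given `φ j`. -/
theorem le_splittingNumber [Nontrivial R] (hF : IsFFinite R p)
    (D : CartierSubalgebra R p) (e : ℕ) {b : ℕ} (φ : Fin b → CartierMap R p e)
    (hφ : ∀ i, φ i ∈ D.part e) (hs : ∀ v : Fin b → R, ∃ x : R, ∀ i, φ i (push R p e x) = v i) :
    b ≤ splittingNumber D e := by
  classical
  choose x hx using fun j : Fin b => hs (Pi.single j 1)
  let y : Fin b → FrobPush R p e := fun j => push R p e (x j)
  have hy : ∀ i j, φ i (y j) = if i = j then 1 else 0 := fun i j => by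
    rw [hx j i, Pi.single_apply]
  let K : Submodule R (FrobPush R p e) := LinearMap.ker (LinearMap.pi φ)
  have hK : ∀ z ∈ K, ∀ i, φ i z = 0 := fun z hz i => congrFun (LinearMap.mem_ker.1 hz) i
  let M : Fin (b + 1) → Submodule R (FrobPush R p e) := Fin.cons K fun j => Submodule.span R {y j}
  have hMs : ∀ j : Fin b, M j.succ = Submodule.span R {y j} := fun j => rfl
  have hvan : ∀ (j : Fin b) (i : Fin (b + 1)), i ≠ j.succ → ∀ z ∈ M i, φ j z = 0 := by
    intro j i
    refine Fin.cases ?_ (fun l => ?_) i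
    · exact fun _ z hz => hK z hz j
    · intro hl z hz
      rw [hMs, Submodule.mem_span_singleton] at hz
      obtain ⟨r, rfl⟩ := hz
      rw [map_smul, hy, if_neg, smul_zero]
      exact fun h => hl (by rw [h])
  have hinj : ∀ (j : Fin b), ∀ z ∈ M j.succ, φ j z = 0 → z = 0 := by
    intro j z hz h
    rw [hMs, Submodule.mem_span_singleton] at hz
    obtain ⟨r, rfl⟩ := hz
    rw [map_smul, hy, if_pos rfl, smul_eq_mul, mul_one] at h
    rw [h, zero_smul]
  have hM : DirectSum.IsInternal M := by
    constructor
    · rw [injective_iff_map_eq_zero]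
      intro w hw
      have hsum : ∑ i, (w i : FrobPush R p e) = 0 := by
        rw [← hw, DirectSum.coeAddMonoidHom_eq_dfinsuppSum, DFinsupp.sum_eq_sum_fintype _ fun i => rfl]
        rfl
      have h1 : ∀ j : Fin b, (w j.succ : FrobPush R p e) = 0 := by
        intro j
        apply hinj j _ (w j.succ).2
        have := congrArg (φ j) hsum
        rwa [map_sum, Finset.sum_eq_single j.succ, map_zero] at this
        · exact fun i _ hi => hvan j i hi _ (w i).2
        · exact fun h => absurd (Finset.mem_univ _) h
      have h0 : (w 0 : FrobPush R p e) = 0 := by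
        rw [Fin.sum_univ_succ] at hsum
        simpa [h1] using hsum
      refine DFinsupp.ext fun i => Subtype.ext ?_
      exact Fin.cases h0 h1 i
    · intro z
      let w : ∀ i, M i := Fin.cons (⟨z - ∑ j, φ j z • y j, by
          refine LinearMap.mem_ker.2 (funext fun i => ?_)
          simp [hy]⟩ : K) fun j => (⟨φ j z • y j, by
          exact Submodule.smul_mem _ _ (Submodule.mem_span_singleton_self _)⟩ :
          Submodule.span R {y j})
      refine ⟨DFinsupp.equivFunOnFintype.symm w, ?_⟩
      rw [DirectSum.coeAddMonoidHom_eq_dfinsuppSum, DFinsupp.sum_eq_sum_fintype _ fun i => rfl,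
        Fin.sum_univ_succ]
      change (z - ∑ j, φ j z • y j) + ∑ j, φ j z • y j = z
      abel
  have hsub : ∀ j : Fin b, IsDSummand D e M hM j.succ := by
    intro j
    have hbij : Function.Bijective ((φ j) ∘ₗ (M j.succ).subtype) := by
      constructor
      · rw [injective_iff_map_eq_zero]
        exact fun z hz => Subtype.ext (hinj j z z.2 hz)
      · intro r
        refine ⟨⟨r • y j, Submodule.smul_mem _ _ (Submodule.mem_span_singleton_self _)⟩, ?_⟩
        simp [hy]
    refine ⟨LinearEquiv.ofBijective _ hbij, ?_⟩
    convert hφ j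
    ext z
    exact summandProj_apply_eq M hM j.succ (φ j) (hvan j) z
  have hmem := (isGreatest_splittingNumber hF D e).2 ⟨b + 1, M, hM, rfl⟩
  refine le_trans ?_ hmem
  have : (Set.range (Fin.succ : Fin b → Fin (b + 1))).ncard = b := by
    rw [← Set.image_univ, Set.ncard_image_of_injective _ (Fin.succ_injective b)]
    simp
  calc b = (Set.range (Fin.succ : Fin b → Fin (b + 1))).ncard := this.symm
    _ ≤ _ := Set.ncard_le_ncard (by rintro _ ⟨j, rfl⟩; exact hsub j) (Set.toFinite _)

end SplittingNumberBounds

/-! ### Selecting a jointly surjective subfamily over the residue field -/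

section Selection

variable {R : Type u} [CommRing R] [IsLocalRing R] {p : ℕ} [Fact p.Prime] [CharP R p]

open IsLocalRing

theorem exists_surjective_insert {e : ℕ} {ι : Type*} [DecidableEq ι] (φ : ι → CartierMap R p e)
    {S : Finset ι} (hS : ∀ v : ι → R, ∃ x : R, ∀ i ∈ S, φ i (push R p e x) = v i) {i : ι}
    {x₀ : R} (h0 : ∀ j ∈ S, φ j (push R p e x₀) ∈ maximalIdeal R)
    (hi : IsUnit (φ i (push R p e x₀))) (v : ι → R) :
    ∃ x : R, ∀ j ∈ insert i S, φ j (push R p e x) = v j := by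
  choose y hy using fun j : ι => hS (Pi.single j 1)
  -- Correct `x₀` so that all maps in `S` kill it; the coefficients lie in the maximal ideal, so the
  -- value of `φ i` stays a unit.
  set x₁ : FrobPush R p e :=
    push R p e x₀ - ∑ j ∈ S, φ j (push R p e x₀) • push R p e (y j) with hx₁
  have h1 : ∀ l ∈ S, φ l x₁ = 0 := by
    intro l hl
    rw [hx₁, map_sub, map_sum, Finset.sum_eq_single l]
    · rw [map_smul, hy l l hl, Pi.single_eq_same, smul_eq_mul, mul_one, sub_self]
    · intro j _ hj
      rw [map_smul, hy j l hl, Pi.single_eq_of_ne (Ne.symm hj), smul_zero]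
    · exact fun h => absurd hl h
  have h2 : IsUnit (φ i x₁) := by
    have hm : ∑ j ∈ S, φ j (push R p e x₀) * φ i (push R p e (y j)) ∈ maximalIdeal R :=
      Ideal.sum_mem _ fun j hj => Ideal.mul_mem_right _ _ (h0 j hj)
    have h3 : φ i x₁ = φ i (push R p e x₀) -
        ∑ j ∈ S, φ j (push R p e x₀) * φ i (push R p e (y j)) := by
      simp only [hx₁, map_sub, map_sum, map_smul, smul_eq_mul]
    by_contra h
    have h4 : φ i x₁ ∈ maximalIdeal R := (mem_maximalIdeal _).2 h
    have := Ideal.add_mem _ h4 hm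
    rw [h3, sub_add_cancel] at this
    exact (mem_maximalIdeal _).1 this hi
  obtain ⟨a, ha⟩ := h2
  obtain ⟨x, hx⟩ := hS v
  refine ⟨(push R p e).symm (push R p e x +
    ((v i - φ i (push R p e x)) * (a⁻¹ : Rˣ)) • x₁), fun j hj => ?_⟩
  rw [AddEquiv.apply_symm_apply, map_add, map_smul, smul_eq_mul]
  rcases Finset.mem_insert.1 hj with rfl | hj
  · rw [← ha, mul_assoc, Units.inv_mul, mul_one, add_sub_cancel]
  · rw [h1 j hj, mul_zero, add_zero, hx j hj]

/-- Let `V` be the image of the joint map in `k ^ ι` and `S` a maximal jointly surjective subfamily.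
By maximality a vector of `V` vanishing on `S` is zero, so `dim V ≤ |S|`, while `V` and the `|κ|`
extra vectors span `k ^ ι`. -/
theorem card_le_splittingNumber_add (hF : IsFFinite R p) (D : CartierSubalgebra R p) (e : ℕ)
    {ι κ : Type*} [Fintype ι] [Fintype κ] (φ : ι → CartierMap R p e) (hφ : ∀ i, φ i ∈ D.part e)
    (u : κ → ι → R)
    (h : ∀ v : ι → R, ∃ (x : R) (r : κ → R), ∀ i, v i = φ i (push R p e x) + ∑ l, r l * u l i) :
    Fintype.card ι ≤ splittingNumber D e + Fintype.card κ := by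
  classical
  let T : Set (Finset ι) := {S | ∀ v : ι → R, ∃ x : R, ∀ i ∈ S, φ i (push R p e x) = v i}
  obtain ⟨S, hST, hSmax⟩ : ∃ S, Maximal (· ∈ T) S :=
    (Set.toFinite T).exists_maximal ⟨∅, fun v => ⟨0, by simp⟩⟩
  have hcard : S.card ≤ splittingNumber D e := by
    refine le_splittingNumber hF D e (fun j => φ (S.equivFin.symm j)) (fun j => hφ _) fun v => ?_
    obtain ⟨x, hx⟩ := hST fun i => if h : i ∈ S then v (S.equivFin ⟨i, h⟩) else 0
    refine ⟨x, fun j => ?_⟩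
    rw [hx _ (S.equivFin.symm j).2, dif_pos (S.equivFin.symm j).2]
    simp
  let k := ResidueField R
  let V : Submodule k (ι → k) :=
    { carrier := {v | ∃ x : R, ∀ i, v i = residue R (φ i (push R p e x))}
      add_mem' := by
        rintro v w ⟨x, hx⟩ ⟨y, hy⟩
        exact ⟨x + y, fun i => by rw [Pi.add_apply, hx, hy, map_add, map_add, map_add]⟩
      zero_mem' := ⟨0, fun i => by simp⟩
      smul_mem' := by
        rintro c v ⟨x, hx⟩
        obtain ⟨c, rfl⟩ := residue_surjective c
        exact ⟨c ^ p ^ e * x, fun i => by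
          rw [Pi.smul_apply, hx, ← smul_push, map_smul, smul_eq_mul, smul_eq_mul, map_mul]⟩ }
  let ρ : V →ₗ[k] (S → k) := (LinearMap.funLeft k k (Subtype.val : S → ι)) ∘ₗ V.subtype
  have hρ : Function.Injective ρ := by
    rw [injective_iff_map_eq_zero]
    rintro ⟨v, x, hx⟩ hv
    refine Subtype.ext (funext fun i => ?_)
    change v i = 0
    have hvS : ∀ j ∈ S, v j = 0 := fun j hj => congrFun hv ⟨j, hj⟩
    by_contra hvi
    have hiS : i ∉ S := fun hi => hvi (hvS i hi)
    have hins : insert i S ∈ T := by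
      refine exists_surjective_insert φ hST (x₀ := x) (fun j hj => ?_) ?_
      · rw [← residue_eq_zero_iff, ← hx, hvS j hj]
      · rwa [← residue_ne_zero_iff_isUnit, ← hx]
    exact hiS (hSmax hins (Finset.subset_insert i S) (Finset.mem_insert_self i S))
  have hV : Module.finrank k V ≤ S.card := by
    simpa using LinearMap.finrank_le_finrank_of_injective hρ
  let W : Submodule k (ι → k) := Submodule.span k (Set.range fun l : κ => fun i => residue R (u l i))
  have hW : Module.finrank k W ≤ Fintype.card κ := finrank_range_le_card _
  have htop : V ⊔ W = ⊤ := by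
    rw [eq_top_iff]
    intro v _
    choose v' hv' using fun i => residue_surjective (v i)
    obtain ⟨x, r, hxr⟩ := h v'
    refine Submodule.mem_sup.2 ⟨fun i => residue R (φ i (push R p e x)), ⟨x, fun i => rfl⟩,
      ∑ l, residue R (r l) • fun i => residue R (u l i), ?_, ?_⟩
    · exact Submodule.sum_mem _ fun l _ => Submodule.smul_mem _ _ (Submodule.subset_span ⟨l, rfl⟩)
    · funext i
      rw [← hv' i, hxr i]
      simp [Finset.sum_apply]
  have := Submodule.finrank_add_le_finrank_add_finrank V W
  rw [htop, finrank_top, Module.finrank_fintype_fun_eq_card] at this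
  omega

end Selection

/-! ### Counting generators of Frobenius pushforwards -/

section FrobGen

variable {R : Type u} [CommRing R]

/-- Modulo `F^e_* I`, every element of `F^e_* J` lies in a fixed `R`-submodule of `F^e_* R`
generated by `g` elements. -/
def FrobGen (p e : ℕ) (J I : Ideal R) (g : ℕ) : Prop :=
  ∃ u : Fin g → R, ∀ x ∈ J, ∃ r : Fin g → R, x - ∑ i, r i ^ p ^ e * u i ∈ I

variable {p e : ℕ} {J I K : Ideal R} {g h : ℕ}

theorem FrobGen.of_fintype {ι : Type*} [Fintype ι] (u : ι → R)
    (hu : ∀ x ∈ J, ∃ r : ι → R, x - ∑ i, r i ^ p ^ e * u i ∈ I) :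
    FrobGen p e J I (Fintype.card ι) := by
  let E := Fintype.equivFin ι
  refine ⟨u ∘ E.symm, fun x hx => ?_⟩
  obtain ⟨r, hr⟩ := hu x hx
  refine ⟨r ∘ E.symm, ?_⟩
  rwa [← E.symm.sum_comp fun i => r i ^ p ^ e * u i] at hr

theorem FrobGen.mono_right (hu : FrobGen p e J I g) (h : I ≤ K) : FrobGen p e J K g := by
  obtain ⟨u, hu⟩ := hu
  exact ⟨u, fun x hx => (hu x hx).imp fun r hr => h hr⟩

theorem FrobGen.of_le (h : J ≤ I) : FrobGen p e J I 0 :=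
  ⟨Fin.elim0, fun x hx => ⟨Fin.elim0, by simpa using h hx⟩⟩

theorem FrobGen.trans (h1 : FrobGen p e J I g) (h2 : FrobGen p e I K h) :
    FrobGen p e J K (g + h) := by
  obtain ⟨u, hu⟩ := h1
  obtain ⟨w, hw⟩ := h2
  have := FrobGen.of_fintype (p := p) (e := e) (J := J) (I := K) (Sum.elim u w) fun x hx => by
    obtain ⟨r, hr⟩ := hu x hx
    obtain ⟨s, hs⟩ := hw _ hr
    refine ⟨Sum.elim r s, ?_⟩
    simpa [Fintype.sum_sum_type, sub_sub] using hs
  simpa using this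

/-- Modulo `I`, the ideal `J` is covered by the cyclic modules on the `y i`, each a quotient of
`R/K`. -/
theorem FrobGen.of_mul_le (hK : FrobGen p e ⊤ K g) {ι : Type*} [Fintype ι] (y : ι → R)
    (hJ : J ≤ I ⊔ Ideal.span (Set.range y)) (hI : ∀ i, ∀ a ∈ K, a * y i ∈ I) :
    FrobGen p e J I (Fintype.card ι * g) := by
  obtain ⟨u, hu⟩ := hK
  have := FrobGen.of_fintype (p := p) (e := e) (J := J) (I := I)
    (fun ij : ι × Fin g => u ij.2 * y ij.1) fun x hx => by
      obtain ⟨z, hz, w, hw, rfl⟩ := Submodule.mem_sup.1 (hJ hx)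
      obtain ⟨c, rfl⟩ := (Ideal.mem_span_range_iff_exists_fun).1 hw
      choose r hr using fun i => hu (c i) trivial
      refine ⟨fun ij => r ij.1 ij.2, ?_⟩
      rw [Fintype.sum_prod_type]
      have : z + ∑ i, c i * y i - ∑ i, ∑ j, r i j ^ p ^ e * (u j * y i) =
          z + ∑ i, (c i - ∑ j, r i j ^ p ^ e * u j) * y i := by
        simp only [sub_mul, Finset.sum_sub_distrib, Finset.sum_mul, mul_assoc]
        ring
      rw [this]
      exact Ideal.add_mem _ hz (Ideal.sum_mem _ fun i _ => hI i _ (hr i))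
  simpa using this

/-- Filter by the powers of `y`: each of the `n` successive quotients is a quotient of `R/(I + y)`.
-/
theorem FrobGen.sup_span_pow {y : R} (h : FrobGen p e ⊤ (I ⊔ Ideal.span {y}) g) (n : ℕ) :
    FrobGen p e ⊤ (I ⊔ Ideal.span {y ^ n}) (n * g) := by
  induction n with
  | zero => rw [zero_mul]; exact FrobGen.of_le (by simp)
  | succ n ih =>
    rw [add_mul]
    refine ih.trans (?_ : FrobGen p e _ _ (1 * g))
    have := h.of_mul_le (J := I ⊔ Ideal.span {y ^ n}) (I := I ⊔ Ideal.span {y ^ (n + 1)})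
      (fun _ : Unit => y ^ n) ?_ ?_
    · simpa using this
    · rw [Set.range_const]
      exact sup_le_sup_right le_sup_left _
    · rintro - a ha
      obtain ⟨z, hz, w, hw, rfl⟩ := Submodule.mem_sup.1 ha
      obtain ⟨c, rfl⟩ := Ideal.mem_span_singleton'.1 hw
      rw [add_mul]
      refine Submodule.add_mem_sup (Ideal.mul_mem_right _ _ hz) ?_
      exact Ideal.mem_span_singleton'.2 ⟨c, by ring⟩

theorem FrobGen.sup_span_image_pow (n : ℕ) (s : Finset R) :
    ∀ {I : Ideal R}, FrobGen p e ⊤ (I ⊔ Ideal.span (s : Set R)) g →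
      FrobGen p e ⊤ (I ⊔ Ideal.span ((fun y => y ^ n) '' (s : Set R))) (n ^ s.card * g) := by
  classical
  induction s using Finset.induction_on with
  | empty => intro I h; simpa using h
  | insert a s ha ih =>
    intro I h
    rw [Finset.coe_insert, Ideal.span_insert, ← sup_assoc] at h
    have h1 := ih h
    rw [sup_right_comm] at h1
    have h2 := h1.sup_span_pow n
    rw [Finset.coe_insert, Set.image_insert_eq, Ideal.span_insert, Finset.card_insert_of_notMem ha,
      ← sup_assoc, sup_right_comm, pow_succ', mul_assoc]
    exact h2

variable [Fact p.Prime] [CharP R p]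

/-- Since `F^e_*(y ^ q) = y • F^e_* 1`, the ideal generated by the `q`-th powers of `s` pushes
forward into `𝔪 • F^e_* R`, and Nakayama's lemma discards it. -/
theorem FrobGen.nakayama [IsLocalRing R] (hF : IsFFinite R p) {s : Set R}
    (hs : s ⊆ IsLocalRing.maximalIdeal R)
    (h : FrobGen p e ⊤ (I ⊔ Ideal.span ((fun y => y ^ p ^ e) '' s)) g) : FrobGen p e ⊤ I g := by
  obtain ⟨u, hu⟩ := h
  have := finite_frobPush hF e
  let N : Submodule R (FrobPush R p e) :=
    { carrier := {z | ∃ r : Fin g → R, (push R p e).symm z - ∑ i, r i ^ p ^ e * u i ∈ I}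
      zero_mem' := ⟨0, by
        simp [zero_pow (pow_ne_zero e (Fact.out : p.Prime).ne_zero)]⟩
      add_mem' := by
        rintro a b ⟨r, hr⟩ ⟨t, ht⟩
        refine ⟨r + t, ?_⟩
        have := Ideal.add_mem _ hr ht
        convert this using 1
        simp only [map_add, Pi.add_apply, add_pow_char_pow, add_mul, Finset.sum_add_distrib]
        ring
      smul_mem' := by
        rintro c a ⟨r, hr⟩
        refine ⟨fun i => c * r i, ?_⟩
        obtain ⟨a, rfl⟩ := (push R p e).surjective a
        rw [smul_push, AddEquiv.symm_apply_apply]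
        have := Ideal.mul_mem_left _ (c ^ p ^ e) hr
        convert this using 1
        simp only [AddEquiv.symm_apply_apply, mul_sub, Finset.mul_sum, mul_pow, mul_assoc] }
  have hN : (⊤ : Submodule R (FrobPush R p e)) ≤ N := by
    refine Submodule.le_of_le_smul_of_le_jacobson_bot (I := IsLocalRing.maximalIdeal R)
      Module.Finite.fg_top (IsLocalRing.maximalIdeal_le_jacobson _) ?_
    intro z _
    obtain ⟨x, rfl⟩ := (push R p e).surjective z
    obtain ⟨r, hr⟩ := hu x trivial
    obtain ⟨a, ha, b, hb, hab⟩ := Submodule.mem_sup.1 hr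
    have hx : x = (∑ i, r i ^ p ^ e * u i + a) + b := by
      rw [add_assoc, hab]; ring
    rw [hx, map_add]
    refine Submodule.add_mem_sup ⟨r, by simpa using ha⟩ ?_
    refine Submodule.span_induction ?_ ?_ ?_ ?_ hb
    · rintro _ ⟨y, hy, rfl⟩
      have : push R p e (y ^ p ^ e) = y • push R p e 1 := by rw [smul_push, mul_one]
      rw [this]
      exact Submodule.smul_mem_smul (hs hy) trivial
    · simp
    · intro a b _ _ ha hb
      rw [map_add]; exact Submodule.add_mem _ ha hb
    · intro c w hw hwm
      clear hab hb hx
      rw [smul_eq_mul]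
      have hle : ∀ z ∈ IsLocalRing.maximalIdeal R • (⊤ : Submodule R (FrobPush R p e)),
          push R p e (c * (push R p e).symm z) ∈
            IsLocalRing.maximalIdeal R • (⊤ : Submodule R (FrobPush R p e)) := by
        intro z hz
        refine Submodule.smul_induction_on hz ?_ ?_
        · intro r hr n _
          obtain ⟨n, rfl⟩ := (push R p e).surjective n
          rw [smul_push, AddEquiv.symm_apply_apply, mul_left_comm, ← smul_push]
          exact Submodule.smul_mem_smul hr trivial
        · intro a b ha hb
          rw [map_add, mul_add, map_add]
          exact Submodule.add_mem _ ha hb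
      simpa using hle _ hwm
  refine ⟨u, fun x _ => ?_⟩
  obtain ⟨r, hr⟩ := hN (Submodule.mem_top : push R p e x ∈ ⊤)
  exact ⟨r, by simpa using hr⟩

/-- The degree `[k : k^p]` for the residue field `k`. -/
noncomputable def residueDegree (R : Type u) [CommRing R] [IsLocalRing R] (p : ℕ) [Fact p.Prime]
    [CharP R p] : ℕ :=
  haveI := charP_residueField R p
  Module.finrank (frobenius (IsLocalRing.ResidueField R) p).fieldRange
    (IsLocalRing.ResidueField R)

theorem finite_residueField_fieldRange_frobenius [IsLocalRing R] (hF : IsFFinite R p) :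
    haveI := charP_residueField R p
    Module.Finite (frobenius (IsLocalRing.ResidueField R) p).fieldRange
      (IsLocalRing.ResidueField R) := by
  have := charP_residueField R p
  have : Module.Finite R (FrobPush R p 1) := hF
  obtain ⟨s, hs⟩ := Module.Finite.fg_top (R := R) (M := FrobPush R p 1)
  classical
  refine ⟨s.image fun z => IsLocalRing.residue R ((push R p 1).symm z), ?_⟩
  · rw [eq_top_iff]
    intro x _
    obtain ⟨x, rfl⟩ := IsLocalRing.residue_surjective x
    have key : ∀ z ∈ Submodule.span R (s : Set (FrobPush R p 1)),
        IsLocalRing.residue R ((push R p 1).symm z) ∈ Submodule.span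
          (frobenius (IsLocalRing.ResidueField R) p).fieldRange
          ((s.image fun z => IsLocalRing.residue R ((push R p 1).symm z) : Finset _) : Set
            (IsLocalRing.ResidueField R)) := by
      intro z hz
      induction hz using Submodule.span_induction with
      | mem z hz => exact Submodule.subset_span (by simpa using ⟨z, hz, rfl⟩)
      | zero => simp
      | add a b _ _ ha hb => rw [map_add, map_add]; exact Submodule.add_mem _ ha hb
      | smul c w _ hw =>
        obtain ⟨w, rfl⟩ := (push R p 1).surjective w
        rw [smul_push, AddEquiv.symm_apply_apply, map_mul]
        rw [AddEquiv.symm_apply_apply] at hw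
        have := Submodule.smul_mem _ (⟨frobenius _ p (IsLocalRing.residue R c), ⟨_, rfl⟩⟩ :
          (frobenius (IsLocalRing.ResidueField R) p).fieldRange) hw
        rwa [pow_one, map_pow]
    exact key (push R p 1 x) (by rw [hs]; trivial)

theorem residueDegree_pos [IsLocalRing R] (hF : IsFFinite R p) : 0 < residueDegree R p := by
  have := charP_residueField R p
  have := finite_residueField_fieldRange_frobenius hF
  exact Module.finrank_pos

theorem frobGen_maximalIdeal_one [IsLocalRing R] (hF : IsFFinite R p) :
    FrobGen p 1 ⊤ (IsLocalRing.maximalIdeal R) (residueDegree R p) := by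
  have := charP_residueField R p
  have := finite_residueField_fieldRange_frobenius hF
  let b := Module.finBasis (frobenius (IsLocalRing.ResidueField R) p).fieldRange
    (IsLocalRing.ResidueField R)
  choose u hu using fun i => IsLocalRing.residue_surjective (b i)
  refine ⟨u, fun x _ => ?_⟩
  have hc : ∀ i, ∃ r : R, frobenius _ p (IsLocalRing.residue R r) =
      (b.repr (IsLocalRing.residue R x) i : IsLocalRing.ResidueField R) := by
    intro i
    obtain ⟨c, hc⟩ := (b.repr (IsLocalRing.residue R x) i).2
    obtain ⟨r, rfl⟩ := IsLocalRing.residue_surjective c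
    exact ⟨r, hc⟩
  choose r hr using hc
  refine ⟨r, ?_⟩
  rw [← IsLocalRing.residue_eq_zero_iff, map_sub, sub_eq_zero, map_sum]
  conv_lhs => rw [← b.sum_repr (IsLocalRing.residue R x)]
  refine Finset.sum_congr rfl fun i _ => ?_
  rw [map_mul, hu, map_pow, pow_one, Subfield.smul_def, ← hr, frobenius_def, smul_eq_mul]

/-- Generators multiply along the tower of Frobenius iterates: those for `e + 1` are the products `w
^ q * u` of generators `w` for exponent `1` and `u` for `e`. -/
theorem frobGen_maximalIdeal [IsLocalRing R] (hF : IsFFinite R p) (e : ℕ) :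
    FrobGen p e ⊤ (IsLocalRing.maximalIdeal R) (residueDegree R p ^ e) := by
  induction e with
  | zero =>
    simpa using FrobGen.of_fintype (p := p) (e := 0) (J := ⊤) (I := IsLocalRing.maximalIdeal R)
      (fun _ : Unit => 1) fun x _ => ⟨fun _ => x, by simp⟩
  | succ e ih =>
    obtain ⟨u, hu⟩ := ih
    obtain ⟨w, hw⟩ := frobGen_maximalIdeal_one hF
    have := FrobGen.of_fintype (p := p) (e := e + 1) (J := ⊤)
      (I := IsLocalRing.maximalIdeal R)
      (fun ij : Fin (residueDegree R p ^ e) × Fin (residueDegree R p) => w ij.2 ^ p ^ e * u ij.1)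
      fun x hx => by
        obtain ⟨r, hr⟩ := hu x hx
        choose t ht using fun i => hw (r i) trivial
        refine ⟨fun ij => t ij.1 ij.2, ?_⟩
        rw [Fintype.sum_prod_type]
        have hsum : ∀ i, ∑ j, t i j ^ p ^ (e + 1) * (w j ^ p ^ e * u i) =
            (∑ j, t i j ^ p ^ 1 * w j) ^ p ^ e * u i := by
          intro i
          rw [sum_pow_char_pow, Finset.sum_mul]
          refine Finset.sum_congr rfl fun j _ => ?_
          rw [mul_pow, ← pow_mul, pow_one, pow_succ', mul_assoc]
        have : x - ∑ i, ∑ j, t i j ^ p ^ (e + 1) * (w j ^ p ^ e * u i) =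
            (x - ∑ i, r i ^ p ^ e * u i) +
              ∑ i, (r i - ∑ j, t i j ^ p ^ 1 * w j) ^ p ^ e * u i := by
          simp only [hsum, sub_pow_char_pow, sub_mul, Finset.sum_sub_distrib]
          ring
        rw [this]
        refine Ideal.add_mem _ hr (Ideal.sum_mem _ fun i _ => Ideal.mul_mem_right _ _ ?_)
        exact Ideal.pow_mem_of_mem _ (ht i) _ (pow_pos (Fact.out : p.Prime).pos e)
    simpa [pow_succ] using this

theorem exists_frobGen_maximalIdeal_pow [IsLocalRing R] [IsNoetherianRing R] (hF : IsFFinite R p)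
    (N : ℕ) : ∃ l : ℕ, ∀ e, FrobGen p e ⊤ (IsLocalRing.maximalIdeal R ^ N)
      (l * residueDegree R p ^ e) := by
  induction N with
  | zero => exact ⟨0, fun e => by rw [zero_mul]; exact FrobGen.of_le (by simp)⟩
  | succ N ih =>
    obtain ⟨l, hl⟩ := ih
    obtain ⟨n, y, hy⟩ := Submodule.fg_iff_exists_fin_generating_family.1
      (IsNoetherian.noetherian (IsLocalRing.maximalIdeal R ^ N))
    refine ⟨l + n, fun e => ?_⟩
    rw [add_mul]
    refine (hl e).trans ?_
    have := (frobGen_maximalIdeal hF e).of_mul_le (J := IsLocalRing.maximalIdeal R ^ N)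
      (I := IsLocalRing.maximalIdeal R ^ (N + 1)) y (by rw [← hy]; exact le_sup_right) ?_
    · simpa using this
    · intro i a ha
      rw [pow_succ']
      refine Ideal.mul_mem_mul ha ?_
      rw [← hy]
      exact Submodule.subset_span ⟨i, rfl⟩

/-- Replacing each element of `s` by its `q`-th power costs a factor `q`; then the powers can be
dropped by Nakayama. The constant `l` does not depend on `e`. -/
theorem exists_frobGen_of_pow_le [IsLocalRing R] [IsNoetherianRing R] (hF : IsFFinite R p)
    (I : Ideal R) (s : Finset R) (hs : (s : Set R) ⊆ IsLocalRing.maximalIdeal R)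
    (N : ℕ) (hN : IsLocalRing.maximalIdeal R ^ N ≤ I ⊔ Ideal.span (s : Set R)) :
    ∃ l : ℕ, ∀ e, FrobGen p e ⊤ I ((p ^ e) ^ s.card * (l * residueDegree R p ^ e)) := by
  obtain ⟨l, hl⟩ := exists_frobGen_maximalIdeal_pow hF N
  exact ⟨l, fun e => (((hl e).mono_right hN).sup_span_image_pow (p ^ e) s).nakayama hF hs⟩

end FrobGen

/-! ### Generator growth in terms of Krull dimension -/

section Dimension

variable {R : Type u} [CommRing R] [IsLocalRing R] [IsNoetherianRing R]

open IsLocalRing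

/-- Lift a system of parameters of `R/I`. -/
theorem exists_finset_pow_maximalIdeal_le (I : Ideal R) (hI : I ≠ ⊤) (δ : ℕ)
    (h : ringKrullDim (R ⧸ I) ≤ δ) :
    ∃ (s : Finset R) (N : ℕ), s.card ≤ δ ∧ (s : Set R) ⊆ maximalIdeal R ∧
      maximalIdeal R ^ N ≤ I ⊔ Ideal.span (s : Set R) := by
  classical
  have : Nontrivial (R ⧸ I) := Ideal.Quotient.nontrivial_iff.2 hI
  have : IsLocalRing (R ⧸ I) :=
    IsLocalRing.of_surjective' (Ideal.Quotient.mk I) Ideal.Quotient.mk_surjective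
  obtain ⟨s, hs, hcard⟩ := Ideal.exists_finset_card_eq_height_of_isNoetherianRing
    (maximalIdeal (R ⧸ I))
  have hsδ : s.card ≤ δ := by
    rw [← maximalIdeal_height_eq_ringKrullDim, ← hcard] at h
    exact_mod_cast h
  have hrad : maximalIdeal (R ⧸ I) ≤ (Ideal.span (s : Set (R ⧸ I))).radical := by
    rw [Ideal.radical_eq_sInf]
    refine le_sInf fun J hJ => ?_
    exact hs.2 ⟨hJ.2, hJ.1⟩ (le_maximalIdeal hJ.2.ne_top)
  obtain ⟨N, hN⟩ := Ideal.exists_pow_le_of_le_radical_of_fg hrad (IsNoetherian.noetherian _)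
  choose lift hlift using Ideal.Quotient.mk_surjective (I := I)
  have hmem : ∀ x : R, Ideal.Quotient.mk I x ∈ maximalIdeal (R ⧸ I) ↔ x ∈ maximalIdeal R := by
    intro x
    have : IsLocalHom (Ideal.Quotient.mk I) :=
      .of_surjective _ Ideal.Quotient.mk_surjective
    rw [mem_maximalIdeal, mem_maximalIdeal, mem_nonunits_iff, mem_nonunits_iff, isUnit_map_iff]
  refine ⟨s.image lift, N, Finset.card_image_le.trans hsδ, ?_, ?_⟩
  · intro x hx
    obtain ⟨y, hy, rfl⟩ := Finset.mem_image.1 (Finset.mem_coe.1 hx)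
    refine (hmem _).1 ?_
    rw [hlift]
    exact hs.1.2 (Ideal.subset_span hy)
  · have hmap : (Ideal.span (s.image lift : Set R)).map (Ideal.Quotient.mk I) =
        Ideal.span (s : Set (R ⧸ I)) := by
      rw [Ideal.map_span, Finset.coe_image, ← Set.image_comp]
      congr 1
      convert Set.image_id _
      exact funext hlift
    rw [← Ideal.comap_map_quotientMk, hmap, ← Ideal.map_le_iff_le_comap, Ideal.map_pow]
    refine (Ideal.pow_right_mono ?_ N).trans hN
    exact Ideal.map_le_iff_le_comap.2 fun x hx => (hmem x).2 hx

variable {p : ℕ} [Fact p.Prime] [CharP R p]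

theorem exists_frobGen_of_ringKrullDim_le (hF : IsFFinite R p) (I : Ideal R) (δ : ℕ)
    (h : ringKrullDim (R ⧸ I) ≤ δ) :
    ∃ C : ℕ, ∀ e, ∃ g, g ≤ C * (p ^ δ * residueDegree R p) ^ e ∧ FrobGen p e ⊤ I g := by
  by_cases hI : I = ⊤
  · exact ⟨0, fun e => ⟨0, zero_le, FrobGen.of_le hI.ge⟩⟩
  obtain ⟨s, N, hcard, hs, hN⟩ := exists_finset_pow_maximalIdeal_le I hI δ h
  obtain ⟨l, hl⟩ := exists_frobGen_of_pow_le hF I s hs N hN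
  refine ⟨l, fun e => ⟨_, ?_, hl e⟩⟩
  have h1 : (p ^ e) ^ s.card ≤ (p ^ e) ^ δ :=
    Nat.pow_le_pow_right (pow_pos (Fact.out : p.Prime).pos e) hcard
  calc (p ^ e) ^ s.card * (l * residueDegree R p ^ e)
      ≤ (p ^ e) ^ δ * (l * residueDegree R p ^ e) := Nat.mul_le_mul_right _ h1
    _ = l * (p ^ δ * residueDegree R p) ^ e := by rw [mul_pow, ← pow_mul, ← pow_mul]; ring

theorem exists_frobGen_bot (hF : IsFFinite R p) {d : ℕ} (hd : ringKrullDim R = d) :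
    ∃ C : ℕ, ∀ e, ∃ g, g ≤ C * (p ^ d * residueDegree R p) ^ e ∧ FrobGen p e ⊤ (⊥ : Ideal R) g := by
  refine exists_frobGen_of_ringKrullDim_le hF ⊥ d ?_
  rw [← hd]
  exact ringKrullDim_quotient_le ⊥

/-- A nonzerodivisor lowers the dimension, which saves a factor `p ^ e`. This is the error estimate
behind every later limit. -/
theorem exists_frobGen_span_singleton (hF : IsFFinite R p) {d : ℕ} (hd : ringKrullDim R = d)
    {c : R} (hc : c ∈ nonZeroDivisors R) :
    ∃ C : ℕ, ∀ e, ∃ g, g * p ^ e ≤ C * (p ^ d * residueDegree R p) ^ e ∧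
      FrobGen p e ⊤ (Ideal.span {c}) g := by
  by_cases hu : IsUnit c
  · exact ⟨0, fun e => ⟨0, by simp, FrobGen.of_le (Ideal.span_singleton_eq_top.2 hu).ge⟩⟩
  have : Nontrivial (R ⧸ Ideal.span {c}) :=
    Ideal.Quotient.nontrivial_iff.2 (by rwa [Ne, Ideal.span_singleton_eq_top])
  have hdim := ringKrullDim_quotient_succ_le_of_nonZeroDivisor hc
  have h0 : 0 ≤ ringKrullDim (R ⧸ Ideal.span {c}) := ringKrullDim_nonneg_of_nontrivial
  rw [hd] at hdim
  obtain ⟨δ, rfl⟩ : ∃ δ, d = δ + 1 := by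
    refine Nat.exists_eq_succ_of_ne_zero ?_
    rintro rfl
    have h1 : (0 : WithBot ℕ∞) + 1 ≤ 0 := (add_le_add_left h0 1).trans (by exact_mod_cast hdim)
    exact absurd h1 (by decide)
  have h1 : ringKrullDim (R ⧸ Ideal.span {c}) ≤ δ := by
    obtain ⟨n, hn⟩ : ∃ n : ℕ∞, ringKrullDim (R ⧸ Ideal.span {c}) = n :=
      WithBot.ne_bot_iff_exists.1 (by rintro h; rw [h] at h0; exact absurd h0 (by decide)) |>.imp
        fun _ h => h.symm
    rw [hn] at hdim ⊢
    have h2 : n + 1 ≤ (δ : ℕ∞) + 1 := by exact_mod_cast hdim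
    have h3 : n ≤ δ := (ENat.add_le_add_iff_right (by simp)).1 h2
    exact_mod_cast h3
  obtain ⟨C, hC⟩ := exists_frobGen_of_ringKrullDim_le hF _ δ h1
  refine ⟨C, fun e => ?_⟩
  obtain ⟨g, hg, hgen⟩ := hC e
  refine ⟨g, ?_, hgen⟩
  calc g * p ^ e ≤ C * (p ^ δ * residueDegree R p) ^ e * p ^ e := Nat.mul_le_mul_right _ hg
    _ = C * (p ^ (δ + 1) * residueDegree R p) ^ e := by
      rw [mul_assoc, ← mul_pow]; ring

end Dimension

/-! ### Generic rank of `F^e_* R` over a domain -/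

section GenericRank

theorem exists_smul_mem_of_finrank_eq {R M : Type*} [CommRing R] [IsDomain R] [AddCommGroup M]
    [Module R M] [Module.Finite R M] (N : Submodule R M)
    (h : Module.finrank R N = Module.finrank R M) : ∃ c : R, c ≠ 0 ∧ ∀ z, c • z ∈ N := by
  have h1 := N.finrank_quotient_add_finrank
  have h2 : Module.IsTorsion R (M ⧸ N) :=
    Module.finrank_eq_zero_iff_isTorsion.1 (by omega)
  obtain ⟨c, hc, hc0⟩ := Submodule.annihilator_top_inter_nonZeroDivisors h2
  refine ⟨c, nonZeroDivisors.ne_zero hc0, fun z => ?_⟩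
  have := Submodule.mem_annihilator.1 hc (Submodule.Quotient.mk z) trivial
  rwa [← Submodule.Quotient.mk_smul, Submodule.Quotient.mk_eq_zero] at this

theorem finrank_eq_of_smul_mem {R M : Type*} [CommRing R] [IsDomain R] [AddCommGroup M]
    [Module R M] [Module.Finite R M] (N : Submodule R M) {c : R} (hc : c ≠ 0)
    (h : ∀ z, c • z ∈ N) : Module.finrank R N = Module.finrank R M := by
  have h1 := N.finrank_quotient_add_finrank
  have h2 : Module.finrank R (M ⧸ N) = 0 := by
    refine Module.finrank_eq_zero_iff_isTorsion.2 fun z => ?_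
    induction z using Submodule.Quotient.induction_on with
    | _ z =>
      refine ⟨⟨c, mem_nonZeroDivisors_of_ne_zero hc⟩, ?_⟩
      rw [Submonoid.mk_smul, ← Submodule.Quotient.mk_smul, Submodule.Quotient.mk_eq_zero]
      exact h z
  omega

variable {R : Type u} [CommRing R] {p : ℕ} [Fact p.Prime] [CharP R p]

variable (R p) in
/-- The generic rank of `F^e_* R`. -/
noncomputable def frobRank (e : ℕ) : ℕ := Module.finrank R (FrobPush R p e)

theorem frobRank_le_of_frobGen [Nontrivial R] {e g : ℕ} (h : FrobGen p e ⊤ (⊥ : Ideal R) g) :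
    frobRank R p e ≤ g := by
  obtain ⟨u, hu⟩ := h
  have : Submodule.span R (Set.range fun i => push R p e (u i)) = ⊤ := by
    rw [eq_top_iff]
    intro z _
    obtain ⟨z, rfl⟩ := (push R p e).surjective z
    obtain ⟨r, hr⟩ := hu z trivial
    rw [Submodule.mem_span_range_iff_exists_fun]
    refine ⟨r, ?_⟩
    simp only [smul_push, ← map_sum]
    rw [Ideal.mem_bot, sub_eq_zero] at hr
    rw [← hr]
  simpa [frobRank] using finrank_le_of_span_eq_top this

variable [IsDomain R]

theorem splittingNumber_le_frobRank (hF : IsFFinite R p) (D : CartierSubalgebra R p) (e : ℕ) :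
    splittingNumber D e ≤ frobRank R p e := by
  have := finite_frobPush hF e
  obtain ⟨φ, -, hs⟩ := exists_surjective_of_splittingNumber hF D e
  have hr : LinearMap.range (LinearMap.pi φ) = ⊤ := by
    rw [eq_top_iff]
    intro v _
    obtain ⟨x, hx⟩ := hs v
    exact ⟨push R p e x, funext hx⟩
  have := LinearMap.finrank_range_le (LinearMap.pi φ)
  rw [hr, finrank_top] at this
  simpa [frobRank] using this

theorem exists_generic_basis (hF : IsFFinite R p) (e : ℕ) :
    ∃ x : Fin (frobRank R p e) → R, LinearIndependent R (fun i => push R p e (x i)) ∧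
      ∃ c : R, c ≠ 0 ∧ ∀ z : FrobPush R p e,
        c • z ∈ Submodule.span R (Set.range fun i => push R p e (x i)) := by
  have := finite_frobPush hF e
  obtain ⟨y, hy⟩ := exists_linearIndependent_of_le_finrank (R := R) (M := FrobPush R p e)
    (n := frobRank R p e) le_rfl
  have hx : LinearIndependent R fun i => push R p e ((push R p e).symm (y i)) := by simpa using hy
  refine ⟨fun i => (push R p e).symm (y i), hx, ?_⟩
  apply exists_smul_mem_of_finrank_eq
  rw [finrank_span_eq_card hx, Fintype.card_fin]
  rfl

/-- Generic bases `x` of `F^a_* R` and `y` of `F^b_* R` give the generic basis `y j ^ p ^ a * x i`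
of `F^{a+b}_* R`, as for degrees in a tower of fields. -/
theorem frobRank_add (hF : IsFFinite R p) (a b : ℕ) :
    frobRank R p (a + b) = frobRank R p a * frobRank R p b := by
  have := finite_frobPush hF (a + b)
  obtain ⟨x, hx, c, hc, hcx⟩ := exists_generic_basis hF a
  obtain ⟨y, hy, d, hd, hdy⟩ := exists_generic_basis hF b
  rw [Fintype.linearIndependent_iff] at hx hy
  let w : Fin (frobRank R p a) × Fin (frobRank R p b) → FrobPush R p (a + b) :=
    fun ij => push R p (a + b) (y ij.2 ^ p ^ a * x ij.1)
  have hsum : ∀ r : Fin (frobRank R p a) × Fin (frobRank R p b) → R,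
      ∑ ij, r ij • w ij =
        push R p (a + b) (∑ i, (∑ j, r (i, j) ^ p ^ b * y j) ^ p ^ a * x i) := by
    intro r
    rw [Fintype.sum_prod_type, map_sum]
    refine Finset.sum_congr rfl fun i _ => ?_
    rw [sum_pow_char_pow, Finset.sum_mul, map_sum]
    refine Finset.sum_congr rfl fun j _ => ?_
    rw [smul_push, mul_pow, ← pow_mul, ← pow_add, add_comm b a, mul_assoc]
  have hw : LinearIndependent R w := by
    rw [Fintype.linearIndependent_iff]
    rintro r hr ⟨i, j⟩
    rw [hsum, EmbeddingLike.map_eq_zero_iff] at hr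
    have h1 := hx (fun i => ∑ j, r (i, j) ^ p ^ b * y j) (by
      simp only [smul_push, ← map_sum]
      rw [hr, map_zero]) i
    refine hy (fun j => r (i, j)) ?_ j
    simp only [smul_push, ← map_sum]
    rw [h1, map_zero]
  have htor : ∀ z : FrobPush R p (a + b), (c * d) • z ∈ Submodule.span R (Set.range w) := by
    intro z
    obtain ⟨z, rfl⟩ := (push R p (a + b)).surjective z
    -- The exponent `p ^ b` makes this scalar act in `F^a_* R` as `c` acts in `F^{a+b}_* R`.
    have h1 : (c ^ p ^ b) • push R p a z ∈
        Submodule.span R (Set.range fun i => push R p a (x i)) := by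
      obtain ⟨k, hk⟩ := Nat.exists_eq_succ_of_ne_zero
        (pow_ne_zero b (Fact.out : p.Prime).ne_zero)
      rw [hk, pow_succ, mul_smul]
      exact Submodule.smul_mem _ _ (hcx _)
    obtain ⟨t, ht⟩ := Submodule.mem_span_range_iff_exists_fun R |>.1 h1
    choose r hr using fun i => (Submodule.mem_span_range_iff_exists_fun R).1 (hdy (push R p b (t i)))
    simp only [smul_push, ← map_sum, EmbeddingLike.apply_eq_iff_eq] at ht hr
    refine (Submodule.mem_span_range_iff_exists_fun R).2 ⟨fun ij => r ij.1 ij.2, ?_⟩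
    rw [hsum, smul_push]
    congr 1
    simp only [hr, mul_pow, mul_assoc, ← Finset.mul_sum, ht]
    rw [← pow_mul, ← pow_mul, ← pow_add, add_comm b a]
    ring
  have h1 := finrank_eq_of_smul_mem _ (mul_ne_zero hc hd) htor
  rw [finrank_span_eq_card hw] at h1
  rw [frobRank, ← h1]
  simp

theorem frobRank_eq_pow (hF : IsFFinite R p) (e : ℕ) : frobRank R p e = frobRank R p 1 ^ e := by
  induction e with
  | zero =>
    have h := frobRank_add hF 0 0
    have h1 : frobRank R p 0 ≠ 0 := by
      have := finite_frobPush hF 0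
      intro h0
      have := Module.finrank_eq_zero_iff_isTorsion.1 h0
      obtain ⟨a, ha⟩ := @this (push R p 0 1)
      change (a : R) • push R p 0 1 = 0 at ha
      rw [smul_push, EmbeddingLike.map_eq_zero_iff, pow_zero, pow_one, mul_one] at ha
      exact nonZeroDivisors.coe_ne_zero a ha
    rw [pow_zero]
    exact (Nat.eq_of_mul_eq_mul_left (Nat.pos_of_ne_zero h1) (by simpa using h)).symm
  | succ e ih => rw [frobRank_add hF, ih, pow_succ]

/-- Precompose one nonzero `ψ ∈ D_n` with multiplication by each member of a generic basis. The
joint map is injective between modules of equal rank, so its image contains a nonzero multiple of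
the free module. -/
theorem exists_smul_mem_range (hF : IsFFinite R p) (D : CartierSubalgebra R p) {n : ℕ}
    (hn : D.part n ≠ ⊥) : ∃ (c : R) (Ψ : Fin (frobRank R p n) → CartierMap R p n), c ≠ 0 ∧
      (∀ i, Ψ i ∈ D.part n) ∧
      ∀ v : Fin (frobRank R p n) → R, ∃ z : R, ∀ i, Ψ i (push R p n z) = c * v i := by
  have := finite_frobPush hF n
  obtain ⟨ψ, hψD, hψ⟩ := (D.part n).bot_or_exists_ne_zero.resolve_left hn
  obtain ⟨x, hx, c, hc, hcx⟩ := exists_generic_basis hF n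
  let Ψ : Fin (frobRank R p n) → CartierMap R p n := fun i => ψ.mulPush (x i)
  obtain ⟨y, hy⟩ : ∃ y, ψ (push R p n y) ≠ 0 := by
    by_contra! h
    exact hψ (LinearMap.ext fun z => h ((push R p n).symm z))
  have hinj : Function.Injective (LinearMap.pi Ψ) := by
    rw [injective_iff_map_eq_zero]
    intro z hz
    obtain ⟨z, rfl⟩ := (push R p n).surjective z
    have h0 : ∀ i, ψ (push R p n (x i * z)) = 0 := fun i => congrFun hz i
    have hall : ∀ w, ψ (push R p n (w * z)) = 0 := by
      intro w
      obtain ⟨r, hr⟩ := (Submodule.mem_span_range_iff_exists_fun R).1 (hcx (push R p n w))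
      simp only [smul_push, ← map_sum, EmbeddingLike.apply_eq_iff_eq] at hr
      have h1 : c * ψ (push R p n (w * z)) = 0 := by
        rw [← smul_eq_mul, ← map_smul, smul_push, ← mul_assoc, ← hr, Finset.sum_mul]
        simp only [mul_assoc]
        rw [CartierMap.map_sum_pow_mul]
        simp [h0]
      exact (mul_eq_zero.1 h1).resolve_left hc
    by_contra hz0
    have hz1 : z ≠ 0 := fun h => hz0 (by rw [h, map_zero])
    obtain ⟨k, hk⟩ := Nat.exists_eq_succ_of_ne_zero (pow_ne_zero n (Fact.out : p.Prime).ne_zero)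
    -- With `k + 1 = p ^ n`, multiplying by `z` completes a full power, and `ψ` returns `z * ψ(y) ≠
    -- 0`.
    have h2 := hall (z ^ k * y)
    have h3 : z ^ k * y * z = z ^ p ^ n * y := by rw [hk, pow_succ]; ring
    rw [h3, ← smul_push, map_smul, smul_eq_mul] at h2
    exact mul_ne_zero hz1 hy h2
  have hrange : Module.finrank R (LinearMap.range (LinearMap.pi Ψ)) =
      Module.finrank R (Fin (frobRank R p n) → R) := by
    rw [LinearMap.finrank_range_of_inj hinj, Module.finrank_fin_fun]
    rfl
  obtain ⟨c', hc', h⟩ := exists_smul_mem_of_finrank_eq _ hrange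
  refine ⟨c', Ψ, hc', fun i => D.mulPush_mem hψD _, fun v => ?_⟩
  obtain ⟨z, hz⟩ := h v
  exact ⟨(push R p n).symm z, fun i => by simpa using congrFun hz i⟩

/-- Compose a surjective family `Φ` of degree `e` with the family `Ψ` of degree `n`. As `Ψ` reaches
every multiple of `c`, the products miss at most what `F^e_*(R/c)` contributes, once for each member
of `Ψ`. -/
theorem exists_frobRank_mul_splittingNumber_le [IsLocalRing R] (hF : IsFFinite R p)
    (D : CartierSubalgebra R p) {n : ℕ} (hn : D.part n ≠ ⊥) :
    ∃ c : R, c ≠ 0 ∧ ∀ e g, FrobGen p e ⊤ (Ideal.span {c}) g →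
      frobRank R p n * splittingNumber D e ≤
        splittingNumber D (e + n) + frobRank R p n * g := by
  classical
  obtain ⟨c, Ψ, hc, hΨD, hΨ⟩ := exists_smul_mem_range hF D hn
  refine ⟨c, hc, fun e g ⟨u, hu⟩ => ?_⟩
  obtain ⟨Φ, hΦD, hΦ⟩ := exists_surjective_of_splittingNumber hF D e
  have := card_le_splittingNumber_add hF D (e + n)
    (ι := Fin (splittingNumber D e) × Fin (frobRank R p n))
    (κ := Fin (frobRank R p n) × Fin g)
    (fun ji => (Φ ji.1).mul (Ψ ji.2)) (fun ji => D.mul_mem (hΦD _) (hΨD _))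
    (fun il ji => if il.1 = ji.2 then Φ ji.1 (push R p e (u il.2)) else 0) ?_
  · simpa [mul_comm] using this
  intro v
  choose w hw using fun i => hΦ fun j => v (j, i)
  choose r hr using fun i => hu (w i) trivial
  choose z hz using fun i => Ideal.mem_span_singleton'.1 (hr i)
  obtain ⟨x, hx⟩ := hΨ z
  refine ⟨x, fun il => r il.1 il.2, ?_⟩
  rintro ⟨j, i⟩
  have h1 : w i = c * z i + ∑ l, r i l ^ p ^ e * u l := by
    rw [mul_comm c, hz]; ring
  rw [Fintype.sum_prod_type, Finset.sum_eq_single i]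
  · simp only [if_true]
    rw [CartierMap.mul_apply, hx, ← hw i j, h1, map_add, map_add, CartierMap.map_sum_pow_mul]
  · intro i' _ hi'
    simp [hi']
  · simp

end GenericRank

/-! ### Convergence of almost increasing sequences along a semigroup -/

section Limits

theorem le_add_of_le_add_geometric {x : ℕ → ℝ} {b C : ℝ} (hb0 : 0 ≤ b) (hb1 : b < 1) (hC : 0 ≤ C)
    {n : ℕ} (hn : 0 < n) (h : ∀ e, x e ≤ x (e + n) + C * b ^ e) (k : ℕ) :
    ∀ e, x e ≤ x (e + k * n) + C * (1 - b)⁻¹ * b ^ e := by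
  have h1b : 0 < 1 - b := by linarith
  induction k with
  | zero =>
    intro e
    have : 0 ≤ C * (1 - b)⁻¹ * b ^ e := by positivity
    simpa using this
  | succ k ih =>
    intro e
    have h1 := h e
    have h2 := ih (e + n)
    rw [add_assoc, show n + k * n = (k + 1) * n by ring, pow_add] at h2
    have h3 : b ^ n ≤ b := by
      simpa using pow_le_pow_of_le_one hb0 hb1.le hn
    have h4 : 1 + b * (1 - b)⁻¹ = (1 - b)⁻¹ := by field_simp; ring
    have h5 : C * (1 - b)⁻¹ * (b ^ e * b ^ n) ≤ C * (1 - b)⁻¹ * (b ^ e * b) := by gcongr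
    have h6 : C * b ^ e + C * (1 - b)⁻¹ * (b ^ e * b) = C * (1 - b)⁻¹ * b ^ e := by
      calc _ = C * b ^ e * (1 + b * (1 - b)⁻¹) := by ring
        _ = _ := by rw [h4]; ring
    linarith

/-- A bounded sequence that is increasing up to a geometric error along the translations by the
elements of a semigroup of natural numbers converges along this semigroup. -/
theorem exists_tendsto_of_le_add_geometric {x : ℕ → ℝ} {b B : ℝ} (hb0 : 0 ≤ b) (hb1 : b < 1)
    (hB : ∀ e, x e ≤ B) {Γ : Set ℕ} (hadd : ∀ m ∈ Γ, ∀ n ∈ Γ, m + n ∈ Γ) {n₀ : ℕ} (hn₀ : n₀ ∈ Γ)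
    (hpos : 0 < n₀) (h : ∀ n ∈ Γ, ∃ C, 0 ≤ C ∧ ∀ e, x e ≤ x (e + n) + C * b ^ e) :
    ∃ s, Tendsto x (atTop ⊓ 𝓟 Γ) (𝓝 s) := by
  obtain ⟨C₀, hC₀, h₀⟩ := h n₀ hn₀
  have hchain := le_add_of_le_add_geometric hb0 hb1 hC₀ hpos h₀
  -- A difference of elements of `Γ` need not lie in `Γ`. Fix one representative `t r ∈ Γ` of each
  -- residue class modulo `n₀` that meets `Γ`; one jump by `t r` followed by jumps by `n₀` then
  -- suffices, with finitely many constants.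
  have hres : ∀ r : Fin n₀, ∃ (t : ℕ) (C : ℝ), 0 ≤ C ∧ ((∃ m ∈ Γ, m % n₀ = r) →
      t % n₀ = r ∧ ∀ e, x e ≤ x (e + t) + C * b ^ e) := by
    intro r
    by_cases hr : ∃ m ∈ Γ, m % n₀ = r
    · obtain ⟨t, ht, htr⟩ := hr
      obtain ⟨C, hC, hx⟩ := h t ht
      exact ⟨t, C, hC, fun _ => ⟨htr, hx⟩⟩
    · exact ⟨0, 0, le_rfl, fun h => absurd h hr⟩
  choose t C hC htC using hres
  set K := ∑ r, C r + C₀ * (1 - b)⁻¹ with hK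
  have h1b : 0 < 1 - b := by linarith
  have hK0 : 0 ≤ K := add_nonneg (Finset.sum_nonneg fun r _ => hC r) (by positivity)
  set M := Finset.univ.sup t with hM
  have hmul : ∀ (j : ℕ), ∀ e ∈ Γ, ∀ e' ∈ Γ, e' + j * e ∈ Γ := by
    intro j e he e' he'
    induction j with
    | zero => simpa using he'
    | succ j ih => rw [add_mul, one_mul, ← add_assoc]; exact hadd _ ih _ he
  have main : ∀ e ∈ Γ, ∀ e' ∈ Γ, e + M ≤ e' → x e ≤ x e' + K * b ^ e := by
    intro e he e' he' hle
    -- This element of `Γ` is congruent to `e' - e` modulo `n₀`, so the required class has a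
    -- representative.
    have hm := hmul (n₀ - 1) e he e' he'
    let r : Fin n₀ := ⟨(e' + (n₀ - 1) * e) % n₀, Nat.mod_lt _ hpos⟩
    obtain ⟨htr, hx⟩ := htC r ⟨_, hm, rfl⟩
    have htM : t r ≤ M := Finset.le_sup (Finset.mem_univ r)
    have hmod : e + t r ≡ e' [MOD n₀] := by
      have h1 : t r ≡ e' + (n₀ - 1) * e [MOD n₀] := htr
      have h2 : e + (e' + (n₀ - 1) * e) = e' + n₀ * e := by
        obtain ⟨k, rfl⟩ := Nat.exists_eq_succ_of_ne_zero hpos.ne'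
        rw [Nat.succ_sub_one, Nat.succ_eq_add_one]; ring
      refine (h1.add_left e).trans ?_
      rw [h2]
      simp [Nat.ModEq]
    obtain ⟨k, hk⟩ := (Nat.modEq_iff_dvd' (by omega)).1 hmod
    have he'' : e' = e + t r + k * n₀ := by
      rw [mul_comm k, ← hk]; omega
    have h1 := hx e
    have h2 := hchain k (e + t r)
    rw [← he''] at h2
    have h3 : b ^ (e + t r) ≤ b ^ e := pow_le_pow_of_le_one hb0 hb1.le (Nat.le_add_right _ _)
    have h4 : C r ≤ ∑ r, C r := Finset.single_le_sum (fun r _ => hC r) (Finset.mem_univ r)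
    have h5 : C₀ * (1 - b)⁻¹ * b ^ (e + t r) ≤ C₀ * (1 - b)⁻¹ * b ^ e := by gcongr
    have h6 : C r * b ^ e ≤ (∑ r, C r) * b ^ e := by gcongr
    rw [hK, add_mul]
    linarith
  -- The limit is the supremum of the sequence with its error subtracted.
  let A : Set ℝ := (fun e => x e - K * b ^ e) '' Γ
  have hA : BddAbove A := by
    refine ⟨B, ?_⟩
    rintro _ ⟨e, -, rfl⟩
    have : 0 ≤ K * b ^ e := by positivity
    have := hB e
    simp only
    linarith
  have hAne : A.Nonempty := ⟨_, n₀, hn₀, rfl⟩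
  refine ⟨sSup A, tendsto_order.2 ⟨fun a ha => ?_, fun a ha => ?_⟩⟩
  · obtain ⟨_, ⟨e, he, rfl⟩, hae⟩ := exists_lt_of_lt_csSup hAne ha
    rw [eventually_inf_principal]
    filter_upwards [eventually_ge_atTop (e + M)] with e' he' hΓ
    have := main e he e' hΓ he'
    linarith
  · rw [eventually_inf_principal]
    have hlim : Tendsto (fun e => sSup A + K * b ^ e) atTop (𝓝 (sSup A)) := by
      simpa using ((tendsto_pow_atTop_nhds_zero_of_lt_one hb0 hb1).const_mul K).const_add (sSup A)
    filter_upwards [hlim.eventually (gt_mem_nhds ha)] with e he hΓ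
    have := le_csSup hA ⟨e, hΓ, rfl⟩
    simp only at this
    linarith

end Limits

/-! ### The semigroup `Γ_D` and comparison of Cartier subalgebras -/

section Semigroup

variable {R : Type u} [CommRing R] {p : ℕ} [Fact p.Prime] [CharP R p]

theorem mem_semigroup_iff [Nontrivial R] (hF : IsFFinite R p) (D : CartierSubalgebra R p) (e : ℕ) :
    e ∈ semigroup D ↔ ∃ φ ∈ D.part e, ∃ x : R, φ (push R p e x) = 1 := by
  constructor
  · intro he
    obtain ⟨φ, hφ, hs⟩ := exists_surjective_of_splittingNumber hF D e
    let i : Fin (splittingNumber D e) := ⟨0, Nat.pos_of_ne_zero he⟩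
    obtain ⟨x, hx⟩ := hs fun _ => 1
    exact ⟨φ i, hφ i, x, hx i⟩
  · rintro ⟨φ, hφ, x, hx⟩
    have := le_splittingNumber hF D e (fun _ : Fin 1 => φ) (fun _ => hφ)
      fun v => ⟨v 0 ^ p ^ e * x, fun i => by
        rw [← smul_push, map_smul, hx, smul_eq_mul, mul_one, Subsingleton.elim i 0]⟩
    exact Nat.one_le_iff_ne_zero.1 this

theorem add_mem_semigroup [Nontrivial R] (hF : IsFFinite R p) (D : CartierSubalgebra R p) :
    ∀ m ∈ semigroup D, ∀ n ∈ semigroup D, m + n ∈ semigroup D := by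
  intro m hm n hn
  obtain ⟨φ, hφ, x, hx⟩ := (mem_semigroup_iff hF D m).1 hm
  obtain ⟨ψ, hψ, y, hy⟩ := (mem_semigroup_iff hF D n).1 hn
  refine (mem_semigroup_iff hF D _).2 ⟨φ.mul ψ, D.mul_mem hφ hψ, x ^ p ^ n * y, ?_⟩
  rw [CartierMap.mul_apply, ← smul_push, map_smul, hy, smul_eq_mul, mul_one, hx]

theorem part_ne_bot_of_mem_semigroup [Nontrivial R] (hF : IsFFinite R p)
    (D : CartierSubalgebra R p) {n : ℕ} (hn : n ∈ semigroup D) : D.part n ≠ ⊥ := by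
  obtain ⟨φ, hφ, x, hx⟩ := (mem_semigroup_iff hF D n).1 hn
  intro h
  rw [h, AddSubgroup.mem_bot] at hφ
  rw [hφ, LinearMap.zero_apply] at hx
  exact zero_ne_one hx

/-- If `φ(F^e_* z) = 1`, then `x = φ(F^e_*(x ^ q * z))`, so `x ^ q = 0` forces `x = 0`. -/
theorem isReduced_of_mem_semigroup [Nontrivial R] (hF : IsFFinite R p)
    (D : CartierSubalgebra R p) {e : ℕ} (he : e ∈ semigroup D) (hpos : 0 < e) : IsReduced R := by
  obtain ⟨φ, -, z, hz⟩ := (mem_semigroup_iff hF D e).1 he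
  refine (isReduced_iff_pow_one_lt (p ^ e)
    (Nat.one_lt_pow hpos.ne' (Fact.out : p.Prime).one_lt)).2 fun x hx => ?_
  calc x = x • φ (push R p e z) := by rw [hz, smul_eq_mul, mul_one]
    _ = 0 := by rw [← map_smul, smul_push, hx, zero_mul, map_zero, map_zero]

theorem splittingNumber_mono [Nontrivial R] (hF : IsFFinite R p) {D E : CartierSubalgebra R p}
    (h : E ≤ D) (e : ℕ) : splittingNumber E e ≤ splittingNumber D e := by
  obtain ⟨φ, hφ, hs⟩ := exists_surjective_of_splittingNumber hF E e
  exact le_splittingNumber hF D e φ (fun i => h e (hφ i)) hs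

/-- Precomposing a surjective family with `c` leaves a cokernel that is a quotient of `F^e_*(R/c)`.
-/
theorem splittingNumber_le_add_of_mulPush_mem [IsLocalRing R] (hF : IsFFinite R p)
    {D E : CartierSubalgebra R p} {e : ℕ} {c : R} (h : ∀ φ ∈ D.part e, φ.mulPush c ∈ E.part e)
    {g : ℕ} (hg : FrobGen p e ⊤ (Ideal.span {c}) g) :
    splittingNumber D e ≤ splittingNumber E e + g := by
  obtain ⟨φ, hφ, hs⟩ := exists_surjective_of_splittingNumber hF D e
  obtain ⟨u, hu⟩ := hg
  have := card_le_splittingNumber_add hF E e (fun i => (φ i).mulPush c) (fun i => h _ (hφ i))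
    (fun (l : Fin g) i => φ i (push R p e (u l))) fun v => by
      obtain ⟨w, hw⟩ := hs v
      obtain ⟨r, hr⟩ := hu w trivial
      obtain ⟨z, hz⟩ := Ideal.mem_span_singleton'.1 hr
      have h1 : w = c * z + ∑ l, r l ^ p ^ e * u l := by rw [mul_comm c, hz]; ring
      refine ⟨z, r, fun i => ?_⟩
      rw [CartierMap.mulPush_apply, ← hw i]
      conv_lhs => rw [h1]
      rw [map_add, map_add, CartierMap.map_sum_pow_mul]
  simpa using this

end Semigroup

/-! ### Reduced rings that are not domains -/

section NotDomain

variable {R : Type u} [CommRing R]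

theorem sInf_minimalPrimes_eq_bot [IsReduced R] : sInf (minimalPrimes R) = ⊥ := by
  have h : sInf (minimalPrimes R) = nilradical R := Ideal.sInf_minimalPrimes
  rw [h, nilradical_eq_zero]
  rfl

theorem mem_nonZeroDivisors_of_notMem_minimalPrimes [IsReduced R] {c : R}
    (hc : ∀ P ∈ minimalPrimes R, c ∉ P) : c ∈ nonZeroDivisors R := by
  rw [mem_nonZeroDivisors_iff_right]
  intro y hy
  have h : y ∈ sInf (minimalPrimes R) := by
    rw [Submodule.mem_sInf]
    intro P hP
    have : Ideal.IsPrime P := hP.1.1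
    exact (this.mem_or_mem (show y * c ∈ P by rw [hy]; exact zero_mem _)).resolve_right (hc P hP)
  rwa [sInf_minimalPrimes_eq_bot, Ideal.mem_bot] at h

theorem exists_ne_minimalPrimes [Nontrivial R] [IsReduced R] (h : ¬ IsDomain R) :
    ∃ P ∈ minimalPrimes R, ∃ Q ∈ minimalPrimes R, P ≠ Q := by
  by_contra! hPQ
  obtain ⟨P, hP⟩ : (minimalPrimes R).Nonempty :=
    Set.nonempty_coe_sort.1 (Ideal.nonempty_minimalPrimes bot_ne_top)
  have h1 : minimalPrimes R = {P} := Set.eq_singleton_iff_unique_mem.2 ⟨hP, fun Q hQ => hPQ Q hQ P hP⟩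
  have h2 : sInf (minimalPrimes R) = ⊥ := sInf_minimalPrimes_eq_bot
  rw [h1, sInf_singleton] at h2
  have : (⊥ : Ideal R).IsPrime := h2 ▸ hP.1.1
  exact h (IsDomain.of_bot_isPrime R)

/-- The sum of two distinct minimal primes lies in no minimal prime; prime avoidance gives an
element outside all of them. -/
theorem exists_nonZeroDivisor_eq_add [IsNoetherianRing R] [Nontrivial R] [IsReduced R]
    (h : ¬ IsDomain R) :
    ∃ P ∈ minimalPrimes R, ∃ Q ∈ minimalPrimes R, ∃ x ∈ P, ∃ y ∈ Q, x + y ∈ nonZeroDivisors R := by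
  obtain ⟨P, hP, Q, hQ, hPQ⟩ := exists_ne_minimalPrimes h
  refine ⟨P, hP, Q, hQ, ?_⟩
  have hfin := minimalPrimes.finite_of_isNoetherianRing R
  have hnot : ¬ ((P ⊔ Q : Ideal R) : Set R) ⊆ ⋃ I ∈ (hfin.toFinset : Set (Ideal R)), (I : Set R) := by
    rw [Ideal.subset_union_prime P P]
    · rintro ⟨I, hI, hle⟩
      have hI' : I ∈ minimalPrimes R := by simpa using hI
      have h1 : P = I := le_antisymm (le_sup_left.trans hle) (hI'.2 hP.1 (le_sup_left.trans hle))
      have h2 : Q = I := le_antisymm (le_sup_right.trans hle) (hI'.2 hQ.1 (le_sup_right.trans hle))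
      exact hPQ (h1.trans h2.symm)
    · intro I hI _ _
      exact (show I ∈ minimalPrimes R by simpa using hI).1.1
  obtain ⟨c, hc, hcI⟩ := Set.not_subset.1 hnot
  obtain ⟨x, hx, y, hy, rfl⟩ := Submodule.mem_sup.1 hc
  refine ⟨x, hx, y, hy, mem_nonZeroDivisors_of_notMem_minimalPrimes fun I hI hmem => hcI ?_⟩
  simp only [Set.mem_iUnion]
  exact ⟨I, by simpa using hI, hmem⟩

variable [IsLocalRing R] {p : ℕ} [Fact p.Prime] [CharP R p]

/-- An element of a minimal prime is killed by some `y ≠ 0`, hence `y * φ(x) = φ(y ^ q * x) = 0` and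
`φ(x)` is not a unit. -/
theorem CartierMap.apply_mem_maximalIdeal {e : ℕ} (φ : CartierMap R p e) {P : Ideal R}
    (hP : P ∈ minimalPrimes R) {x : R} (hx : x ∈ P) :
    φ (push R p e x) ∈ IsLocalRing.maximalIdeal R := by
  have hx0 : x ∉ nonZeroDivisors R := fun h =>
    Set.disjoint_left.1 (Ideal.disjoint_nonZeroDivisors_of_mem_minimalPrimes hP) hx h
  rw [mem_nonZeroDivisors_iff_right] at hx0
  push Not at hx0
  obtain ⟨y, hyx, hy⟩ := hx0
  rw [IsLocalRing.mem_maximalIdeal]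
  intro hu
  obtain ⟨k, hk⟩ := Nat.exists_eq_succ_of_ne_zero (pow_ne_zero e (Fact.out : p.Prime).ne_zero)
  have h1 : y * φ (push R p e x) = 0 := by
    rw [← smul_eq_mul, ← map_smul, smul_push, hk, pow_succ, mul_assoc, hyx, mul_zero, map_zero,
      map_zero]
  exact hy (hu.mul_left_eq_zero.1 h1)

/-- Modulo `𝔪`, a surjective family factors through `F^e_*(R/c)`. -/
theorem splittingNumber_le_of_apply_mem_maximalIdeal (hF : IsFFinite R p)
    (D : CartierSubalgebra R p) {e : ℕ} {c : R}
    (hc : ∀ (φ : CartierMap R p e) (z : R), φ (push R p e (c * z)) ∈ IsLocalRing.maximalIdeal R)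
    {g : ℕ} (hg : FrobGen p e ⊤ (Ideal.span {c}) g) : splittingNumber D e ≤ g := by
  obtain ⟨φ, hφ, hs⟩ := exists_surjective_of_splittingNumber hF D e
  obtain ⟨u, hu⟩ := hg
  have : Submodule.span (IsLocalRing.ResidueField R) (Set.range fun (l : Fin g)
      (i : Fin (splittingNumber D e)) => IsLocalRing.residue R (φ i (push R p e (u l)))) = ⊤ := by
    rw [eq_top_iff]
    intro v _
    choose v' hv' using fun i => IsLocalRing.residue_surjective (v i)
    obtain ⟨w, hw⟩ := hs v'
    obtain ⟨r, hr⟩ := hu w trivial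
    obtain ⟨z, hz⟩ := Ideal.mem_span_singleton'.1 hr
    have h1 : w = c * z + ∑ l, r l ^ p ^ e * u l := by rw [mul_comm c, hz]; ring
    refine (Submodule.mem_span_range_iff_exists_fun _).2
      ⟨fun l => IsLocalRing.residue R (r l), funext fun i => ?_⟩
    rw [← hv' i, ← hw i]
    conv_rhs => rw [h1]
    rw [map_add, map_add, CartierMap.map_sum_pow_mul, map_add,
      (IsLocalRing.residue_eq_zero_iff _).2 (hc (φ i) z), zero_add]
    simp [Finset.sum_apply]
  simpa using finrank_le_of_span_eq_top this

end NotDomain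

/-! ### Normalized limits -/

section Existence

variable {R : Type u} [CommRing R] [IsLocalRing R] {p : ℕ} [Fact p.Prime] [CharP R p]

theorem rpow_add_alpha (hF : IsFFinite R p) (d e : ℕ) :
    (p : ℝ) ^ ((e : ℝ) * (d + alpha R p)) = ((p ^ d * residueDegree R p : ℕ) : ℝ) ^ e := by
  have hp : 1 < (p : ℝ) := by exact_mod_cast (Fact.out : p.Prime).one_lt
  have hp0 : 0 < (p : ℝ) := by linarith
  have hf : 0 < (residueDegree R p : ℝ) := by exact_mod_cast residueDegree_pos hF
  have ha : (p : ℝ) ^ alpha R p = residueDegree R p := Real.rpow_logb hp0 hp.ne' hf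
  rw [mul_comm, Real.rpow_mul hp0.le, Real.rpow_natCast, Real.rpow_add hp0, ha, Real.rpow_natCast]
  push_cast
  rfl

theorem normalizer_pos (hF : IsFFinite R p) (d : ℕ) : 0 < p ^ d * residueDegree R p :=
  Nat.mul_pos (pow_pos (Fact.out : p.Prime).pos d) (residueDegree_pos hF)

theorem div_normalizer_le {g C n e : ℕ} (hn : 0 < n) (h : g * p ^ e ≤ C * n ^ e) :
    (g : ℝ) / (n : ℝ) ^ e ≤ C * ((p : ℝ)⁻¹) ^ e := by
  have hp0 : 0 < (p : ℝ) := by exact_mod_cast (Fact.out : p.Prime).pos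
  have hn0 : 0 < (n : ℝ) := by exact_mod_cast hn
  have h' : (g : ℝ) * (p : ℝ) ^ e ≤ C * (n : ℝ) ^ e := by exact_mod_cast h
  rw [inv_pow, ← div_eq_mul_inv, div_le_div_iff₀ (by positivity) (by positivity)]
  exact h'

theorem inv_prime_lt_one : ((p : ℝ)⁻¹) < 1 :=
  inv_lt_one_of_one_lt₀ (by exact_mod_cast (Fact.out : p.Prime).one_lt)

theorem tendsto_const_mul_inv_prime_pow (C : ℝ) :
    Tendsto (fun e : ℕ => C * ((p : ℝ)⁻¹) ^ e) atTop (𝓝 0) := by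
  simpa using (tendsto_pow_atTop_nhds_zero_of_lt_one (by positivity)
    (inv_prime_lt_one (p := p))).const_mul C

variable [IsNoetherianRing R]

/-- The rank of `F^e_* R` is an exact `e`-th power and is at most `C * n ^ e` for all `e`; comparing
growth rates removes `C`. -/
theorem frobRank_one_le [IsDomain R] (hF : IsFFinite R p) {d : ℕ} (hd : ringKrullDim R = d) :
    frobRank R p 1 ≤ p ^ d * residueDegree R p := by
  obtain ⟨C, hC⟩ := exists_frobGen_bot hF hd
  by_contra! hlt
  have hn0 : 0 < ((p ^ d * residueDegree R p : ℕ) : ℝ) := by exact_mod_cast normalizer_pos hF d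
  have h1 : 1 < (frobRank R p 1 : ℝ) / ((p ^ d * residueDegree R p : ℕ) : ℝ) := by
    rw [one_lt_div hn0]; exact_mod_cast hlt
  obtain ⟨e, he⟩ := ((tendsto_pow_atTop_atTop_of_one_lt h1).eventually_gt_atTop (C : ℝ)).exists
  obtain ⟨g, hg, hgen⟩ := hC e
  have h2 := (frobRank_le_of_frobGen hgen).trans hg
  rw [frobRank_eq_pow hF] at h2
  rw [div_pow, lt_div_iff₀ (by positivity)] at he
  have h3 : (frobRank R p 1 : ℝ) ^ e ≤ C * ((p ^ d * residueDegree R p : ℕ) : ℝ) ^ e := by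
    exact_mod_cast h2
  linarith

theorem exists_tendsto_of_isDomain [IsDomain R] (hF : IsFFinite R p) {d : ℕ}
    (hd : ringKrullDim R = d) (D : CartierSubalgebra R p) {n₀ : ℕ} (hn₀ : n₀ ∈ semigroup D)
    (hpos : 0 < n₀) :
    ∃ s, Tendsto (fun e : ℕ => (splittingNumber D e : ℝ) /
      ((p ^ d * residueDegree R p : ℕ) : ℝ) ^ e) (atTop ⊓ 𝓟 (semigroup D)) (𝓝 s) := by
  have hle := frobRank_one_le hF hd
  have hgen := fun c hc => exists_frobGen_span_singleton hF hd (c := c) hc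
  have hn := normalizer_pos hF d
  set n := p ^ d * residueDegree R p
  have hn0 : 0 < (n : ℝ) := by exact_mod_cast hn
  have hsplit : ∀ e, (splittingNumber D e : ℝ) / (n : ℝ) ^ e ≤ ((frobRank R p 1 : ℝ) / n) ^ e := by
    intro e
    have h1 := splittingNumber_le_frobRank hF D e
    rw [frobRank_eq_pow hF] at h1
    rw [div_pow]
    gcongr
    exact_mod_cast h1
  -- A rank smaller than the normalizer makes the limit `0`; equality is what turns the composition
  -- inequality into near monotonicity.
  rcases hle.lt_or_eq with hlt | heq
  · refine ⟨0, Tendsto.mono_left ?_ inf_le_left⟩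
    refine squeeze_zero (fun e => by positivity) hsplit ?_
    refine tendsto_pow_atTop_nhds_zero_of_lt_one (by positivity) ?_
    rw [div_lt_one hn0]
    exact_mod_cast hlt
  · refine exists_tendsto_of_le_add_geometric (b := (p : ℝ)⁻¹) (B := 1) (by positivity)
      inv_prime_lt_one (fun e => ?_) (add_mem_semigroup hF D) hn₀ hpos fun k hk => ?_
    · have := hsplit e
      rwa [heq, div_self hn0.ne', one_pow] at this
    · obtain ⟨c, hc, hstep⟩ := exists_frobRank_mul_splittingNumber_le hF D
        (part_ne_bot_of_mem_semigroup hF D hk)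
      obtain ⟨C, hC⟩ := hgen c (mem_nonZeroDivisors_of_ne_zero hc)
      refine ⟨C, by positivity, fun e => ?_⟩
      obtain ⟨g, hg, hfg⟩ := hC e
      have h1 := hstep e g hfg
      rw [frobRank_eq_pow hF, heq] at h1
      have h2 : (n : ℝ) ^ k * splittingNumber D e ≤ splittingNumber D (e + k) + (n : ℝ) ^ k * g := by
        exact_mod_cast h1
      have h3 := div_normalizer_le hn hg
      have h4 : (splittingNumber D e : ℝ) / (n : ℝ) ^ e ≤
          splittingNumber D (e + k) / (n : ℝ) ^ (e + k) + g / (n : ℝ) ^ e := by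
        have hk0 : 0 < (n : ℝ) ^ k := by positivity
        have he0 : 0 < (n : ℝ) ^ e := by positivity
        rw [pow_add, mul_comm ((n : ℝ) ^ e), ← div_div, ← add_div]
        refine div_le_div_of_nonneg_right ?_ he0.le
        rw [div_add' _ _ _ hk0.ne', le_div_iff₀ hk0]
        linarith
      linarith

theorem tendsto_zero_of_not_isDomain [IsReduced R] (h : ¬ IsDomain R) (hF : IsFFinite R p) {d : ℕ}
    (hd : ringKrullDim R = d) (D : CartierSubalgebra R p) :
    Tendsto (fun e : ℕ => (splittingNumber D e : ℝ) /
      ((p ^ d * residueDegree R p : ℕ) : ℝ) ^ e) atTop (𝓝 0) := by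
  obtain ⟨P, hP, Q, hQ, x, hx, y, hy, hxy⟩ := exists_nonZeroDivisor_eq_add h
  obtain ⟨C, hC⟩ := exists_frobGen_span_singleton hF hd hxy
  refine squeeze_zero (fun e => by positivity) (fun e => ?_)
    (tendsto_const_mul_inv_prime_pow (p := p) C)
  obtain ⟨g, hg, hgen⟩ := hC e
  refine le_trans ?_ (div_normalizer_le (normalizer_pos hF d) hg)
  gcongr
  refine splittingNumber_le_of_apply_mem_maximalIdeal hF D (fun φ z => ?_) hgen
  rw [add_mul, map_add, map_add]
  exact Ideal.add_mem _ (φ.apply_mem_maximalIdeal hP (Ideal.mul_mem_right _ _ hx))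
    (φ.apply_mem_maximalIdeal hQ (Ideal.mul_mem_right _ _ hy))

theorem tendsto_sub_of_mulPush_mem (hF : IsFFinite R p) {d : ℕ} (hd : ringKrullDim R = d)
    {D E : CartierSubalgebra R p} (hED : E ≤ D) {c : R} (hc : c ∈ nonZeroDivisors R)
    (h : ∀ e : ℕ, 0 < e → ∀ φ ∈ D.part e, φ.mulPush c ∈ E.part e) :
    Tendsto (fun e : ℕ => (splittingNumber D e : ℝ) / ((p ^ d * residueDegree R p : ℕ) : ℝ) ^ e -
      (splittingNumber E e : ℝ) / ((p ^ d * residueDegree R p : ℕ) : ℝ) ^ e) atTop (𝓝 0) := by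
  obtain ⟨C, hC⟩ := exists_frobGen_span_singleton hF hd hc
  refine squeeze_zero' (Eventually.of_forall fun e => ?_) ?_
    (tendsto_const_mul_inv_prime_pow (p := p) C)
  · rw [sub_nonneg]
    gcongr
    exact splittingNumber_mono hF hED e
  · filter_upwards [eventually_gt_atTop 0] with e he
    obtain ⟨g, hg, hgen⟩ := hC e
    refine le_trans ?_ (div_normalizer_le (normalizer_pos hF d) hg)
    rw [sub_le_iff_le_add', ← add_div]
    gcongr
    exact_mod_cast splittingNumber_le_add_of_mulPush_mem hF (h e he) hgen

end Existence

end FSig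

theorem lemma4p14 {R : Type u} [CommRing R] [IsLocalRing R] [IsNoetherianRing R]
    (p : ℕ) [Fact p.Prime] [CharP R p] (hF : FSig.IsFFinite R p)
    (D E : FSig.CartierSubalgebra R p) (hED : E ≤ D)
    (hc : ∃ c : R, (∀ P ∈ minimalPrimes R, c ∉ P) ∧
      ∀ e : ℕ, 0 < e → ∀ φ ∈ D.part e, φ.mulPush c ∈ E.part e) :
    ∃ s : ℝ, FSig.HasFSignature D s ∧ FSig.HasFSignature E s := by
  obtain ⟨c, hcP, hcE⟩ := hc
  obtain ⟨d, hd⟩ : ∃ d : ℕ, ringKrullDim R = d := by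
    have htop := Ideal.height_ne_top_of_isPrime (I := IsLocalRing.maximalIdeal R)
    obtain ⟨d, hd⟩ := ENat.ne_top_iff_exists.1 htop
    exact ⟨d, by rw [← IsLocalRing.maximalIdeal_height_eq_ringKrullDim, ← hd]; rfl⟩
  have hΓ : FSig.semigroup E ⊆ FSig.semigroup D := by
    intro e he h0
    have := FSig.splittingNumber_mono hF hED e
    exact he (Nat.le_zero.1 (h0 ▸ this))
  rcases (FSig.semigroup D).finite_or_infinite with hfin | hinf
  · exact ⟨0, ⟨d, hd, fun h => absurd hfin h, fun _ => rfl⟩,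
      ⟨d, hd, fun h => absurd (hfin.subset hΓ) h, fun _ => rfl⟩⟩
  obtain ⟨n₀, hn₀, hpos⟩ := hinf.exists_gt 0
  have hred := FSig.isReduced_of_mem_semigroup hF D hn₀ hpos
  have hc0 := FSig.mem_nonZeroDivisors_of_notMem_minimalPrimes hcP
  have hsub := FSig.tendsto_sub_of_mulPush_mem hF hd hED hc0 hcE
  obtain ⟨s, hs⟩ : ∃ s, Tendsto (fun e : ℕ => (FSig.splittingNumber D e : ℝ) /
      ((p ^ d * FSig.residueDegree R p : ℕ) : ℝ) ^ e) (atTop ⊓ 𝓟 (FSig.semigroup D)) (𝓝 s) := by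
    by_cases hdom : IsDomain R
    · exact FSig.exists_tendsto_of_isDomain hF hd D hn₀ hpos
    · exact ⟨0, (FSig.tendsto_zero_of_not_isDomain hdom hF hd D).mono_left inf_le_left⟩
  refine ⟨s, ⟨d, hd, fun _ => ?_, fun h => absurd h hinf⟩, ⟨d, hd, fun _ => ?_, fun hEfin => ?_⟩⟩
  · simpa only [FSig.rpow_add_alpha hF] using hs
  · simp only [FSig.rpow_add_alpha hF]
    have h1 := (hs.mono_left (inf_le_inf_left atTop (principal_mono.2 hΓ))).sub
      (hsub.mono_left (inf_le_left : atTop ⊓ 𝓟 (FSig.semigroup E) ≤ atTop))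
    simpa using h1
  -- If `Γ_E` is finite, then `a_e^E` is eventually `0`, so the difference estimate makes the limit
  -- along the infinite set `Γ_D` vanish, matching the convention for `E`.
  · have hne : (atTop ⊓ 𝓟 (FSig.semigroup D)).NeBot :=
      frequently_mem_iff_neBot.1 (Nat.frequently_atTop_iff_infinite.2 hinf)
    have h0 : ∀ᶠ e in atTop, FSig.splittingNumber E e = 0 := by
      obtain ⟨N, hN⟩ := hEfin.bddAbove
      filter_upwards [eventually_gt_atTop N] with e he
      by_contra h
      exact absurd (hN h) (not_le.2 he)
    have h1 := hsub.mono_left (inf_le_left : atTop ⊓ 𝓟 (FSig.semigroup D) ≤ atTop)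
    refine tendsto_nhds_unique hs (h1.congr' ?_)
    filter_upwards [h0.filter_mono inf_le_left] with e he
    simp [he]
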